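/- Let $d$ be a nonnegative integer and let $\mathcal F^2(\mathbb C^d)$ be the Fock space, i.e. the Hilbert space of entire functions $f$ on $\mathbb C^d$ with $\frac1{\pi^d}\int_{\mathbb C^d}|f(z)|^2e^{-|z|^2}\,dV(z)<\infty$ and inner product $\langle f,g\rangle=\frac1{\pi^d}\int_{\mathbb C^d}f(z)\overline{g(z)}e^{-|z|^2}\,dV(z)$; for vectors write $\langle z,w\rangle=\sum_i z_i\overline{w_i}$. Let $\psi$ be a nonzero entire function on $\mathbb C^d$ and $\varphi:\mathbb C^d\to\mathbb C^d$ a holomorphic map. The maximal weighted composition operator $C_{\psi,\varphi,\max}$ has domain $\{f\in\mathcal F^2(\mathbb C^d):\psi\cdot(f\circ\varphi)\in\mathcal F^2(\mathbb C^d)\}$ and acts by $f\mapsto\psi\cdot(f\circ\varphi)$; a weighted composition operator $C_{\psi,\varphi}$ is any (possibly unbounded) linear operator on $\mathcal F^2(\mathbb C^d)$ that is a restriction of $C_{\psi,\varphi,\max}$. A densely defined operator $S$ is real symmetric if $S=S^*$ and skew-real symmetric if $S=-S^*$ (equality of unbounded operators, domains included). A conjugation is an antilinear, involutive, isometric map $\mathcal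 C$, and a closed densely defined operator $S$ is $\mathcal C$-selfadjoint if $S=\mathcal CS^*\mathcal C$, with the natural domain on the right-hand side. For a $d\times d$ matrix $A$, $b\in\mathbb C^d$ and $c\in\mathbb C$ put $$\mathcal C_{A,b,c}f(z)=c\,e^{\langle z,\overline b\rangle}\,\overline{f\big(\overline{Az+b}\big)}.$$ Proposition. Suppose that the weighted composition operator $C_{\psi,\varphi}$ is real symmetric or skew-real symmetric. Then there are a matrix $A\in\mathbb C^{d\times d}$, a vector $b\in\mathbb C^d$ and a number $c\in\mathbb C$ such that $\mathcal C_{A,b,c}$ is a conjugation on $\mathcal F^2(\mathbb C^d)$ and $C_{\psi,\varphi}$ is $\mathcal C_{A,b,c}$-selfadjoint. Moreover, one can take $b=0$, $c=1$ and $A$ as follows. There are a matrix $Q=Q^*\in\mathbb C^{d\times d}$ and a vector $q\in\mathbb C^d$ with $\varphi(z)=Qz+q$ for all $z$, and $Q$ has a unitary diagonalization $Q=VMV^*$ with $V$ unitary and $M=\operatorname{diag}(m_1,\dots,m_d)$ real. For every such diagonalization there is a unitary $d\times d$ matrix $W$ which is block diagonal with respect to the eigenspaces of $M$ (that is, $W_{ij}=0$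 whenever $m_i\ne m_j$) and satisfies $W^{\mathbf t}V^*q\in\mathbb R^d$; and for every such $W$, with $$A=\overline V\,(WW^{\mathbf t})\,V^*,$$ $\mathcal C_{A,0,1}$ is a conjugation on $\mathcal F^2(\mathbb C^d)$ and $C_{\psi,\varphi}$ is $\mathcal C_{A,0,1}$-selfadjoint. -/

import Mathlib

namespace Fock

noncomputable section

open MeasureTheory Filter Topology
open scoped ENNReal

/-! ### The Fock space `F²(ℂ^d)` -/

/-- The sesquilinear pairing `⟨z, w⟩ = ∑ᵢ zᵢ * conj wᵢ` on `ℂ^d`. -/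
def pairing {d : ℕ} (z w : Fin d → ℂ) : ℂ := ∑ i, z i * starRingEnd ℂ (w i)

/-- The Gaussian measure `π⁻ᵈ exp(-|z|²) dV(z)` on `ℂ^d`, where `|z|² = ∑ᵢ |zᵢ|²` and `dV` is the
Lebesgue measure. -/
def gaussian (d : ℕ) : Measure (Fin d → ℂ) :=
  (volume : Measure (Fin d → ℂ)).withDensity
    fun z => ENNReal.ofReal ((Real.pi ^ d)⁻¹ * Real.exp (-∑ i, ‖z i‖ ^ 2))

/-- A function on `ℂ^d` belongs to the Fock space when it is entire and square integrable
with respect to the Gaussian measure. -/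
def MemFock {d : ℕ} (f : (Fin d → ℂ) → ℂ) : Prop :=
  Differentiable ℂ f ∧ MemLp f 2 (gaussian d)

/-- The Fock space as a vector space of functions on `ℂ^d`. -/
def fockSubmodule (d : ℕ) : Submodule ℂ ((Fin d → ℂ) → ℂ) where
  carrier := {f | MemFock f}
  zero_mem' := ⟨differentiable_const 0, MemLp.zero⟩
  add_mem' hf hg := ⟨hf.1.add hg.1, hf.2.add hg.2⟩
  smul_mem' c _ hf := ⟨hf.1.const_smul c, hf.2.const_smul c⟩

/-- The Fock space `F²(ℂ^d)`; its elements are honest functions. -/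
def FockSpace (d : ℕ) : Type := fockSubmodule d

namespace FockSpace

variable {d : ℕ}

instance : AddCommGroup (FockSpace d) := inferInstanceAs (AddCommGroup (fockSubmodule d))

instance : Module ℂ (FockSpace d) := inferInstanceAs (Module ℂ (fockSubmodule d))

instance : CoeFun (FockSpace d) fun _ => (Fin d → ℂ) → ℂ := ⟨fun f => f.1⟩

/-- Bundle a function of the Fock space. -/
def mk (f : (Fin d → ℂ) → ℂ) (hf : MemFock f) : FockSpace d := ⟨f, hf⟩

@[simp] theorem mk_apply (f : (Fin d → ℂ) → ℂ) (hf : MemFock f) (z : Fin d → ℂ) :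
    mk f hf z = f z := rfl

@[simp] theorem add_apply (f g : FockSpace d) (z : Fin d → ℂ) : (f + g) z = f z + g z := rfl

@[simp] theorem sub_apply (f g : FockSpace d) (z : Fin d → ℂ) : (f - g) z = f z - g z := rfl

@[simp] theorem smul_apply (c : ℂ) (f : FockSpace d) (z : Fin d → ℂ) : (c • f) z = c * f z := rfl

@[ext] theorem ext {f g : FockSpace d} (h : ∀ z, f z = g z) : f = g := Subtype.ext (funext h)

theorem memFock (f : FockSpace d) : MemFock f := f.2

/-- The class of `f` in `L²` of the Gaussian measure. -/
def toLp : FockSpace d →ₗ[ℂ] Lp ℂ 2 (gaussian d) where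
  toFun f := f.memFock.2.toLp f
  map_add' _ _ := rfl
  map_smul' _ _ := rfl

theorem coeFn_toLp (f : FockSpace d) : toLp f =ᵐ[gaussian d] f := f.memFock.2.coeFn_toLp

theorem volume_absolutelyContinuous_gaussian :
    (volume : Measure (Fin d → ℂ)) ≪ gaussian d := by
  refine withDensity_absolutelyContinuous' ?_ ?_
  · exact (ENNReal.continuous_ofReal.comp (by fun_prop)).measurable.aemeasurable
  · refine Eventually.of_forall fun z => ?_
    have : 0 < (Real.pi ^ d)⁻¹ * Real.exp (-∑ i, ‖z i‖ ^ 2) := by positivity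
    simpa using this

theorem eq_of_ae_eq {f g : (Fin d → ℂ) → ℂ} (hf : Continuous f) (hg : Continuous g)
    (h : f =ᵐ[gaussian d] g) : f = g :=
  Continuous.ae_eq_iff_eq (volume : Measure (Fin d → ℂ)) hf hg |>.1
    (volume_absolutelyContinuous_gaussian.ae_eq h)

theorem toLp_injective : Function.Injective (toLp (d := d)) := by
  intro f g h
  refine Subtype.ext (eq_of_ae_eq f.memFock.1.continuous g.memFock.1.continuous ?_)
  exact (coeFn_toLp f).symm.trans (h ▸ coeFn_toLp g)

/-- The inner product of `F²(ℂ^d)`, conjugate linear in the first variable as is the convention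
of Mathlib: `inner f g = ∫ g * conj f` with respect to the Gaussian measure. -/
instance : Inner ℂ (FockSpace d) :=
  ⟨fun f g => ∫ z, g z * starRingEnd ℂ (f z) ∂(gaussian d)⟩

theorem inner_def (f g : FockSpace d) :
    inner ℂ f g = ∫ z, g z * starRingEnd ℂ (f z) ∂(gaussian d) := rfl

theorem inner_eq_inner_toLp (f g : FockSpace d) : inner ℂ f g = inner ℂ (toLp f) (toLp g) := by
  rw [inner_def, L2.inner_def]
  refine integral_congr_ae ?_
  filter_upwards [coeFn_toLp f, coeFn_toLp g] with z h1 h2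
  rw [h1, h2]
  rfl

/-- The axioms of an inner product. -/
abbrev core : InnerProductSpace.Core ℂ (FockSpace d) where
  inner := inner ℂ
  conj_inner_symm f g := by
    rw [inner_eq_inner_toLp, inner_eq_inner_toLp]; exact inner_conj_symm _ _
  re_inner_nonneg f := by rw [inner_eq_inner_toLp]; exact inner_self_nonneg
  add_left f g h := by
    rw [inner_eq_inner_toLp, inner_eq_inner_toLp, inner_eq_inner_toLp, map_add, inner_add_left]
  smul_left f g c := by
    rw [inner_eq_inner_toLp, inner_eq_inner_toLp, map_smul, inner_smul_left]
  definite f h := by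
    rw [inner_eq_inner_toLp, inner_self_eq_zero] at h
    exact toLp_injective (h.trans (map_zero _).symm)

instance : NormedAddCommGroup (FockSpace d) := core.toNormedAddCommGroup

instance : InnerProductSpace ℂ (FockSpace d) := InnerProductSpace.ofCore core.toCore

theorem norm_toLp (f : FockSpace d) : ‖toLp f‖ = ‖f‖ := by
  rw [@norm_eq_sqrt_re_inner ℂ _ _ _ _ f, @norm_eq_sqrt_re_inner ℂ _ _ _ _ (toLp f)]
  congr 2
  exact (inner_eq_inner_toLp f f).symm

theorem eLpNorm_eq (f : FockSpace d) : eLpNorm f 2 (gaussian d) = ENNReal.ofReal ‖f‖ := by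
  rw [← norm_toLp, ← eLpNorm_congr_ae (coeFn_toLp f), Lp.norm_def,
    ENNReal.ofReal_toReal (Lp.eLpNorm_ne_top _)]

end FockSpace

/-! ### Completeness of the Fock space -/

section Complete

variable {d : ℕ}

theorem enorm_le_circle {f : (Fin d → ℂ) → ℂ} (hf : Differentiable ℂ f) (z u : Fin d → ℂ) :
    ENNReal.ofReal (2 * Real.pi) * ‖f z‖ₑ ≤
      ∫⁻ θ in Set.Ioc 0 (2 * Real.pi), ‖f (z + Complex.exp (θ * Complex.I) • u)‖ₑ := by
  have hg : Differentiable ℂ fun t : ℂ => f (z + t • u) := by fun_prop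
  have h := (hg.diffContOnCl (s := Metric.ball (0 : ℂ) |1|)).circleAverage
  simp only [Real.circleAverage_def, circleMap, zero_add, Complex.ofReal_one, one_mul,
    zero_smul, add_zero] at h
  rw [intervalIntegral.integral_of_le (by positivity)] at h
  have h2 : (2 * Real.pi) • f z =
      ∫ θ in Set.Ioc 0 (2 * Real.pi), f (z + Complex.exp (θ * Complex.I) • u) := by
    rw [← h, smul_smul, mul_inv_cancel₀ (by positivity), one_smul]
  calc ENNReal.ofReal (2 * Real.pi) * ‖f z‖ₑ = ‖(2 * Real.pi) • f z‖ₑ := by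
        rw [enorm_smul, Real.enorm_of_nonneg (by positivity)]
    _ ≤ _ := by rw [h2]; exact enorm_integral_le_lintegral_enorm _

theorem measurePreserving_smul {c : ℂ} (hc : ‖c‖ = 1) :
    MeasurePreserving (fun u : Fin d → ℂ => c • u) := by
  have h : MeasurePreserving (fun w : ℂ => c * w) := by
    have := (rotation ⟨c, by simpa [Submonoid.unitSphere] using hc⟩).measurePreserving
    exact this
  exact volume_preserving_pi fun _ : Fin d => h

theorem enorm_le_lintegral_ball {f : (Fin d → ℂ) → ℂ} (hf : Differentiable ℂ f)
    (z : Fin d → ℂ) :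
    volume (Metric.ball (0 : Fin d → ℂ) 1) * ‖f z‖ₑ ≤ ∫⁻ u in Metric.ball z 1, ‖f u‖ₑ := by
  set B := Metric.ball (0 : Fin d → ℂ) 1
  have hc : Continuous f := hf.continuous
  have key : ∀ c : ℂ, ‖c‖ = 1 →
      ∫⁻ u in B, ‖f (z + c • u)‖ₑ = ∫⁻ u in Metric.ball z 1, ‖f u‖ₑ := by
    intro c hc1
    have h1 : MeasurePreserving (fun u : Fin d → ℂ => z + c • u) :=
      (measurePreserving_add_left volume z).comp (measurePreserving_smul hc1)
    have h2 : (fun u : Fin d → ℂ => z + c • u) ⁻¹' Metric.ball z 1 = B := by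
      ext u
      simp [B, norm_smul, hc1]
    rw [← h2]
    exact h1.setLIntegral_comp_preimage Metric.isOpen_ball.measurableSet
      (hc.measurable.enorm)
  have hπ : ENNReal.ofReal (2 * Real.pi) ≠ 0 := by
    simp [Real.pi_pos]
  have : ENNReal.ofReal (2 * Real.pi) * (volume B * ‖f z‖ₑ) ≤
      ENNReal.ofReal (2 * Real.pi) * ∫⁻ u in Metric.ball z 1, ‖f u‖ₑ := by
    calc ENNReal.ofReal (2 * Real.pi) * (volume B * ‖f z‖ₑ)
        = ∫⁻ _ in B, ENNReal.ofReal (2 * Real.pi) * ‖f z‖ₑ := by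
          rw [setLIntegral_const]; ring
      _ ≤ ∫⁻ u in B, ∫⁻ θ in Set.Ioc 0 (2 * Real.pi),
            ‖f (z + Complex.exp (θ * Complex.I) • u)‖ₑ :=
          lintegral_mono fun u => enorm_le_circle hf z u
      _ = ∫⁻ θ in Set.Ioc 0 (2 * Real.pi), ∫⁻ u in B,
            ‖f (z + Complex.exp (θ * Complex.I) • u)‖ₑ := by
          refine lintegral_lintegral_swap ?_
          refine Continuous.aemeasurable ?_
          unfold Function.uncurry
          fun_prop
      _ = ∫⁻ _ in Set.Ioc (0 : ℝ) (2 * Real.pi), ∫⁻ u in Metric.ball z 1, ‖f u‖ₑ := by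
          refine lintegral_congr fun θ => key _ (Complex.norm_exp_ofReal_mul_I θ)
      _ = _ := by
          rw [setLIntegral_const, Real.volume_Ioc, sub_zero, mul_comm]
  exact (ENNReal.mul_le_mul_iff_right hπ ENNReal.ofReal_ne_top).1 this

theorem restrict_ball_le (R : ℝ) : ∃ M : ℝ≥0∞, M ≠ ∞ ∧
    (volume : Measure (Fin d → ℂ)).restrict (Metric.ball 0 R) ≤ M • gaussian d := by
  set w : (Fin d → ℂ) → ℝ≥0∞ :=
    fun z => ENNReal.ofReal ((Real.pi ^ d)⁻¹ * Real.exp (-∑ i, ‖z i‖ ^ 2))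
  set m : ℝ≥0∞ := ENNReal.ofReal ((Real.pi ^ d)⁻¹ * Real.exp (-∑ _i : Fin d, R ^ 2))
  have hm0 : m ≠ 0 := by
    have : 0 < (Real.pi ^ d)⁻¹ * Real.exp (-∑ _i : Fin d, R ^ 2) := by positivity
    simpa [m] using this
  have hm : m ≠ ∞ := ENNReal.ofReal_ne_top
  refine ⟨m⁻¹, ENNReal.inv_ne_top.2 hm0, Measure.le_iff.2 fun s hs => ?_⟩
  rw [Measure.restrict_apply hs, Measure.smul_apply, smul_eq_mul, gaussian,
    withDensity_apply _ hs, ← ENNReal.div_eq_inv_mul, ENNReal.le_div_iff_mul_le (Or.inl hm0)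
    (Or.inl hm)]
  calc volume (s ∩ Metric.ball 0 R) * m = ∫⁻ _ in s ∩ Metric.ball 0 R, m := by
        rw [setLIntegral_const, mul_comm]
    _ ≤ ∫⁻ z in s ∩ Metric.ball 0 R, w z := by
        refine setLIntegral_mono' (hs.inter Metric.isOpen_ball.measurableSet) fun z hz => ?_
        refine ENNReal.ofReal_le_ofReal ?_
        have hz' : ‖z‖ < R := by simpa using hz.2
        gcongr with i
        exact (norm_le_pi_norm z i).trans hz'.le
    _ ≤ _ := lintegral_mono_set Set.inter_subset_left

/-- Point evaluations are bounded, locally uniformly. -/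
theorem exists_norm_apply_le (d : ℕ) (R : ℝ) : ∃ C : ℝ, 0 ≤ C ∧
    ∀ (f : FockSpace d) (z : Fin d → ℂ), ‖z‖ ≤ R → ‖f z‖ ≤ C * ‖f‖ := by
  obtain ⟨M, hM, hle⟩ := restrict_ball_le (d := d) (R + 1)
  set B := Metric.ball (0 : Fin d → ℂ) (R + 1)
  set b := volume (Metric.ball (0 : Fin d → ℂ) 1)
  have hb0 : b ≠ 0 := (Metric.measure_ball_pos _ _ one_pos).ne'
  have hb : b ≠ ∞ := measure_ball_lt_top.ne
  have hB : volume B ≠ ∞ := measure_ball_lt_top.ne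
  set K : ℝ≥0∞ := b⁻¹ * (M ^ (1 / (2 : ℝ)) * volume B ^ (1 / (2 : ℝ)))
  have hK : K ≠ ∞ := ENNReal.mul_ne_top (ENNReal.inv_ne_top.2 hb0)
    (ENNReal.mul_ne_top (ENNReal.rpow_ne_top_of_nonneg (by norm_num) hM)
      (ENNReal.rpow_ne_top_of_nonneg (by norm_num) hB))
  refine ⟨K.toReal, ENNReal.toReal_nonneg, fun f z hz => ?_⟩
  have hmain : ‖f z‖ₑ ≤ K * ENNReal.ofReal ‖f‖ := by
    have hsub : Metric.ball z 1 ⊆ B := by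
      refine Metric.ball_subset_ball' ?_
      rw [dist_zero_right]; linarith
    have hcont : Continuous f := f.memFock.1.continuous
    have h1 : b * ‖f z‖ₑ ≤ eLpNorm f 1 (volume.restrict B) := by
      rw [eLpNorm_one_eq_lintegral_enorm]
      exact (enorm_le_lintegral_ball f.memFock.1 z).trans (lintegral_mono_set hsub)
    have h2 : eLpNorm f 1 (volume.restrict B) ≤
        eLpNorm f 2 (volume.restrict B) * volume B ^ (1 / (2 : ℝ)) := by
      have := eLpNorm_le_eLpNorm_mul_rpow_measure_univ (μ := volume.restrict B)
        (p := 1) (q := 2) (by norm_num) hcont.aestronglyMeasurable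
      refine this.trans_eq ?_
      simp only [Measure.restrict_apply_univ, ENNReal.toReal_one, ENNReal.toReal_ofNat]
      norm_num
    have h3 : eLpNorm f 2 (volume.restrict B) ≤ M ^ (1 / (2 : ℝ)) * ENNReal.ofReal ‖f‖ := by
      refine (eLpNorm_mono_measure f hle).trans ?_
      rw [eLpNorm_smul_measure_of_ne_top (by norm_num), FockSpace.eLpNorm_eq]
      simp
    have h4 : b * ‖f z‖ₑ ≤
        M ^ (1 / (2 : ℝ)) * ENNReal.ofReal ‖f‖ * volume B ^ (1 / (2 : ℝ)) :=
      h1.trans (h2.trans (mul_le_mul_left h3 _))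
    calc ‖f z‖ₑ = b⁻¹ * (b * ‖f z‖ₑ) := by
          rw [← mul_assoc, ENNReal.inv_mul_cancel hb0 hb, one_mul]
      _ ≤ b⁻¹ * (M ^ (1 / (2 : ℝ)) * ENNReal.ofReal ‖f‖ * volume B ^ (1 / (2 : ℝ))) := by
          gcongr
      _ = K * ENNReal.ofReal ‖f‖ := by simp only [K]; ring
  have := ENNReal.toReal_mono (ENNReal.mul_ne_top hK ENNReal.ofReal_ne_top) hmain
  simpa [ENNReal.toReal_mul] using this

/-- Derivatives at points of bounded sets are bounded by the norm. -/
theorem exists_norm_fderiv_le (d : ℕ) (R : ℝ) : ∃ C : ℝ, 0 ≤ C ∧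
    ∀ (f : FockSpace d) (z : Fin d → ℂ), ‖z‖ ≤ R → ‖fderiv ℂ f z‖ ≤ C * ‖f‖ := by
  obtain ⟨C, hC, h⟩ := exists_norm_apply_le d (R + 1)
  refine ⟨C, hC, fun f z hz => ?_⟩
  refine ContinuousLinearMap.opNorm_le_of_unit_norm (𝕜 := ℂ) (by positivity) fun u hu => ?_
  have hf := f.memFock.1
  have hg : Differentiable ℂ fun t : ℂ => f (z + t • u) := by fun_prop
  have hd : deriv (fun t : ℂ => f (z + t • u)) 0 = fderiv ℂ f z u := by
    have h0 : HasDerivAt (fun t : ℂ => z + t • u) u 0 := by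
      simpa using ((hasDerivAt_id (0 : ℂ)).smul_const u).const_add z
    have h1 : HasFDerivAt f (fderiv ℂ f z) (z + (0 : ℂ) • u) := by
      simpa using (hf z).hasFDerivAt
    exact (h1.comp_hasDerivAt (0 : ℂ) h0).deriv
  rw [← hd]
  have := Complex.norm_deriv_le_of_forall_mem_sphere_norm_le (c := 0) (R := 1) (C := C * ‖f‖)
    one_pos hg.diffContOnCl (fun t ht => h f _ ?_)
  · simpa using this
  · have ht1 : ‖t‖ = 1 := by simpa using ht
    refine (norm_add_le _ _).trans ?_
    rw [norm_smul, hu, ht1]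
    linarith

instance : CompleteSpace (FockSpace d) := by
  refine UniformSpace.complete_of_cauchySeq_tendsto fun u hu => ?_
  have hLp : CauchySeq fun n => FockSpace.toLp (u n) := by
    rw [Metric.cauchySeq_iff] at hu ⊢
    intro ε hε
    obtain ⟨N, hN⟩ := hu ε hε
    refine ⟨N, fun m hm n hn => ?_⟩
    rw [dist_eq_norm, ← map_sub, FockSpace.norm_toLp, ← dist_eq_norm]
    exact hN m hm n hn
  obtain ⟨g, hg⟩ := cauchySeq_tendsto_of_complete hLp
  have hpt : ∀ z : Fin d → ℂ, ∃ y, Tendsto (fun n => u n z) atTop (𝓝 y) := by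
    intro z
    refine cauchySeq_tendsto_of_complete ?_
    obtain ⟨C, hC, h⟩ := exists_norm_apply_le d ‖z‖
    rw [Metric.cauchySeq_iff] at hu ⊢
    intro ε hε
    obtain ⟨N, hN⟩ := hu (ε / (C + 1)) (by positivity)
    refine ⟨N, fun m hm n hn => ?_⟩
    have h1 := hN m hm n hn
    rw [dist_eq_norm, lt_div_iff₀ (by positivity)] at h1
    rw [dist_eq_norm, ← FockSpace.sub_apply]
    nlinarith [h (u m - u n) z le_rfl, norm_nonneg (u m - u n)]
  choose F hF using hpt
  have hder : ∀ R : ℝ, UniformCauchySeqOn (fun n => fderiv ℂ (u n)) atTop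
      (Metric.ball (0 : Fin d → ℂ) R) := by
    intro R
    obtain ⟨C, hC, h⟩ := exists_norm_fderiv_le d R
    rw [Metric.uniformCauchySeqOn_iff]
    intro ε hε
    obtain ⟨N, hN⟩ := Metric.cauchySeq_iff.1 hu (ε / (C + 1)) (by positivity)
    refine ⟨N, fun m hm n hn z hz => ?_⟩
    have h1 := hN m hm n hn
    rw [dist_eq_norm, lt_div_iff₀ (by positivity)] at h1
    have h2 := h (u m - u n) z (by simpa using (Metric.mem_ball.1 hz).le)
    have h3 : fderiv ℂ (u m - u n) z = fderiv ℂ (u m) z - fderiv ℂ (u n) z :=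
      fderiv_sub ((u m).memFock.1 z) ((u n).memFock.1 z)
    rw [dist_eq_norm, ← h3]
    nlinarith [norm_nonneg (u m - u n)]
  have hptd : ∀ z : Fin d → ℂ, ∃ y, Tendsto (fun n => fderiv ℂ (u n) z) atTop (𝓝 y) := by
    intro z
    refine cauchySeq_tendsto_of_complete ?_
    exact (hder (‖z‖ + 1)).cauchySeq (by simp)
  choose F' hF' using hptd
  have hFd : Differentiable ℂ F := by
    intro z
    have hz : z ∈ Metric.ball (0 : Fin d → ℂ) (‖z‖ + 1) := by simp
    refine (hasFDerivAt_of_tendstoUniformlyOn (f := fun n => (u n : (Fin d → ℂ) → ℂ))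
      (g' := F') Metric.isOpen_ball
      ((hder (‖z‖ + 1)).tendstoUniformlyOn_of_tendsto fun w _ => hF' w)
      (fun n w _ => ((u n).memFock.1 w).hasFDerivAt) (fun w _ => hF w) hz).differentiableAt
  have hae : F =ᵐ[gaussian d] g := by
    obtain ⟨ns, hns, hns'⟩ := (tendstoInMeasure_of_tendsto_Lp hg).exists_seq_tendsto_ae
    have hall : ∀ᵐ z ∂(gaussian d), ∀ n, FockSpace.toLp (u n) z = u n z :=
      ae_all_iff.2 fun n => FockSpace.coeFn_toLp (u n)
    filter_upwards [hns', hall] with z h1 h2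
    simp only [h2] at h1
    exact tendsto_nhds_unique ((hF z).comp hns.tendsto_atTop) h1
  have hFm : MemFock F := ⟨hFd, (memLp_congr_ae hae).2 (Lp.memLp g)⟩
  refine ⟨FockSpace.mk F hFm, ?_⟩
  have hgF : FockSpace.toLp (FockSpace.mk F hFm) = g :=
    Lp.ext ((FockSpace.coeFn_toLp _).trans hae)
  rw [tendsto_iff_norm_sub_tendsto_zero] at hg ⊢
  refine hg.congr fun n => ?_
  rw [← hgF, ← map_sub, FockSpace.norm_toLp]

end Complete

/-! ### Weighted composition operators -/

section Operators

variable {d : ℕ}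

/-- The formal weighted composition expression `E_{ψ,φ} f = ψ · (f ∘ φ)`. -/
def wcExpr (ψ : (Fin d → ℂ) → ℂ) (φ : (Fin d → ℂ) → (Fin d → ℂ)) (f : (Fin d → ℂ) → ℂ) :
    (Fin d → ℂ) → ℂ := fun z => ψ z * f (φ z)

/-- The maximal weighted composition operator: its domain is the set of all `f` in the Fock space
for which `E_{ψ,φ} f` is again in the Fock space. -/
def maxWCO (ψ : (Fin d → ℂ) → ℂ) (φ : (Fin d → ℂ) → (Fin d → ℂ)) :
    FockSpace d →ₗ.[ℂ] FockSpace d where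
  domain :=
    { carrier := {f | MemFock (wcExpr ψ φ f)}
      zero_mem' := by
        have h : wcExpr ψ φ (0 : FockSpace d) = 0 := by
          funext z; exact mul_zero _
        rw [Set.mem_ofPred_eq, h]
        exact (fockSubmodule d).zero_mem
      add_mem' := by
        intro f g hf hg
        have h : wcExpr ψ φ (f + g : FockSpace d) = wcExpr ψ φ f + wcExpr ψ φ g := by
          funext z; exact mul_add _ _ _
        rw [Set.mem_ofPred_eq, h]
        exact (fockSubmodule d).add_mem hf hg
      smul_mem' := by
        intro c f hf
        have h : wcExpr ψ φ (c • f : FockSpace d) = c • wcExpr ψ φ f := by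
          funext z; exact mul_left_comm _ _ _
        rw [Set.mem_ofPred_eq, h]
        exact (fockSubmodule d).smul_mem c hf }
  toFun :=
    { toFun := fun f => FockSpace.mk (wcExpr ψ φ f.1) f.2
      map_add' := fun _ _ => FockSpace.ext fun _ => mul_add _ _ _
      map_smul' := fun _ _ => FockSpace.ext fun _ => mul_left_comm _ _ _ }

/-- `S` is a weighted composition operator with symbols `ψ, φ`: a linear operator, on some
domain, which is a restriction of the maximal one. -/
def IsWCO (ψ : (Fin d → ℂ) → ℂ) (φ : (Fin d → ℂ) → (Fin d → ℂ))
    (S : FockSpace d →ₗ.[ℂ] FockSpace d) : Prop := S ≤ maxWCO ψ φ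

/-! ### Symmetry notions for unbounded operators on a Hilbert space -/

variable {H : Type*} [NormedAddCommGroup H] [InnerProductSpace ℂ H]

/-- `S = S*` (which presupposes that `S` is densely defined). -/
def IsRealSymmetric [CompleteSpace H] (S : H →ₗ.[ℂ] H) : Prop :=
  Dense (S.domain : Set H) ∧ S = S.adjoint

/-- `S = -S*` (which presupposes that `S` is densely defined). -/
def IsSkewRealSymmetric [CompleteSpace H] (S : H →ₗ.[ℂ] H) : Prop :=
  Dense (S.domain : Set H) ∧ S = -S.adjoint

/-- A conjugation: an antilinear map which is involutive and isometric. -/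
def IsConjugation (J : H →ₛₗ[starRingEnd ℂ] H) : Prop :=
  (∀ f, J (J f) = f) ∧ Isometry J

/-- The operator `J T J` with its natural domain `{f | J f ∈ dom T}`. -/
def conjBy (J : H →ₛₗ[starRingEnd ℂ] H) (T : H →ₗ.[ℂ] H) : H →ₗ.[ℂ] H where
  domain := T.domain.comap J
  toFun :=
    { toFun := fun f => J (T ⟨J f.1, f.2⟩)
      map_add' := by
        intro f g
        rw [← map_add J, ← T.map_add]
        congr 2
        exact Subtype.ext (map_add J f.1 g.1)
      map_smul' := by
        intro c f
        have h : (⟨J (c • f).1, (c • f).2⟩ : T.domain) =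
            starRingEnd ℂ c • (⟨J f.1, f.2⟩ : T.domain) :=
          Subtype.ext (map_smulₛₗ J c f.1)
        rw [h, T.map_smul, map_smulₛₗ]
        simp }

/-- `S` is `J`-selfadjoint: `S` is closed, densely defined and `S = J S* J`. -/
def IsCSelfadjoint [CompleteSpace H] (J : H →ₛₗ[starRingEnd ℂ] H) (S : H →ₗ.[ℂ] H) : Prop :=
  S.IsClosed ∧ Dense (S.domain : Set H) ∧ S = conjBy J S.adjoint

/-! ### The conjugations `𝒞_{A,b,c}` -/

/-- The expression `𝒞_{A,b,c} f (z) = c exp⟨z, conj b⟩ conj (f (conj (A z + b)))`. -/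
def conjExpr (A : Matrix (Fin d) (Fin d) ℂ) (b : Fin d → ℂ) (c : ℂ)
    (f : (Fin d → ℂ) → ℂ) : (Fin d → ℂ) → ℂ :=
  fun z => c * Complex.exp (pairing z (star b)) *
    starRingEnd ℂ (f (star (A.mulVec z + b)))

/-- The expression `𝒞_{A,b,c}` maps the Fock space to itself, the resulting map is a
conjugation, and `S` is selfadjoint with respect to this conjugation. -/
def IsABCSelfadjoint (A : Matrix (Fin d) (Fin d) ℂ) (b : Fin d → ℂ) (c : ℂ)
    (S : FockSpace d →ₗ.[ℂ] FockSpace d) : Prop :=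
  ∃ J : FockSpace d →ₛₗ[starRingEnd ℂ] FockSpace d,
    (∀ f z, J f z = conjExpr A b c f z) ∧ IsConjugation J ∧ IsCSelfadjoint J S

end Operators

end

end Fock

namespace Fock

noncomputable section

open MeasureTheory Filter Topology
open scoped ENNReal

/-! ### Invariance and normalization of the Gaussian measure -/

section Gaussian

variable {d : ℕ}

/-! Write `S = ε S*` with `ε = ±1`, and let `E f = ψ · (f ∘ φ)`. There are three ingredients.

Symbols. The reproducing kernels `K_w` lie in the domain of `S*`, because `⟨S f, K_w⟩ = ψ(w)
f(φ(w))`. Hence they lie in the domain of `S`, and evaluating `S K_w = ε S* K_w` at `z` gives `ψ(z)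
exp⟨φ(z), w⟩ = ε conj ψ(w) exp⟨z, φ(w)⟩` (`IsWCO.kernel_identity`). This forces `ψ(z) = α exp⟨z, q⟩`
with `α = ε conj α`, and `φ(z) = Q z + q` with `Q` Hermitian.

Maximality, the main point. `S` is only assumed to be some restriction of the maximal operator, and
its domain must be shown to be all of `{f | E f ∈ F²}`. Projecting `(f, E f)` onto the closed graph
of `S` leaves a remainder `(h, E h)` orthogonal to it, and `S = ε S*` turns this orthogonality into
`E (E h) = -ε h`. In coordinates diagonalizing `Q` this reads `h(x) = -κ exp⟨x, r⟩ h(p x + r)` with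
`κ > 0` and `p ≥ 0`. Embed the iterates of the affine map in a complex flow. Along it `h`,
multiplied by a suitable exponential, becomes an entire function of time `s` with `F(s + 1) =
-F(s)`. The bound `|h(z)| ≤ ‖h‖ exp(|z|²/2)` makes `F` bounded, so Liouville's theorem gives `F =
0`, hence `h = 0`.

Conjugation. For `A` unitary and symmetric with `A q = conj q` and `A Q = conj Q · A`, the map `J =
𝒞_{A,0,1}` satisfies `E J = ε J E`. It therefore preserves the maximal domain, which is that of `S`,
and `S = J S* J` follows. Checking these conditions for `A = conj V (W Wᵀ) V*` is matrix algebra. -/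

theorem measurePreserving_gaussian {T : (Fin d → ℂ) → (Fin d → ℂ)} (hT : MeasurePreserving T)
    (hn : ∀ z, ∑ i, ‖T z i‖ ^ 2 = ∑ i, ‖z i‖ ^ 2) :
    MeasurePreserving T (gaussian d) (gaussian d) := by
  refine ⟨hT.measurable, ?_⟩
  ext s hs
  have hm : Measurable fun z : Fin d → ℂ =>
      ENNReal.ofReal ((Real.pi ^ d)⁻¹ * Real.exp (-∑ i, ‖z i‖ ^ 2)) :=
    (ENNReal.continuous_ofReal.comp (by fun_prop)).measurable
  rw [Measure.map_apply hT.measurable hs, gaussian, withDensity_apply _ (hT.measurable hs),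
    withDensity_apply _ hs, ← hT.setLIntegral_comp_preimage hs hm]
  simp only [hn]

theorem integral_gaussian (g : (Fin d → ℂ) → ℂ) :
    ∫ z, g z ∂(gaussian d) =
      ∫ z, (((Real.pi ^ d)⁻¹ * Real.exp (-∑ i, ‖z i‖ ^ 2) : ℝ) : ℂ) * g z := by
  have hm : Measurable fun z : Fin d → ℂ =>
      ENNReal.ofReal ((Real.pi ^ d)⁻¹ * Real.exp (-∑ i, ‖z i‖ ^ 2)) :=
    (ENNReal.continuous_ofReal.comp (by fun_prop)).measurable
  rw [gaussian, integral_withDensity_eq_integral_toReal_smul hm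
    (Eventually.of_forall fun _ => ENNReal.ofReal_lt_top)]
  refine integral_congr_ae (Eventually.of_forall fun z => ?_)
  have h0 : 0 ≤ (Real.pi ^ d)⁻¹ * Real.exp (-∑ i, ‖z i‖ ^ 2) := by positivity
  simp only [ENNReal.toReal_ofReal h0, Complex.real_smul]

theorem integrable_gaussian_iff {g : (Fin d → ℂ) → ℂ} :
    Integrable g (gaussian d) ↔
      Integrable fun z => (((Real.pi ^ d)⁻¹ * Real.exp (-∑ i, ‖z i‖ ^ 2) : ℝ) : ℂ) * g z := by
  have hm : Measurable fun z : Fin d → ℂ =>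
      ENNReal.ofReal ((Real.pi ^ d)⁻¹ * Real.exp (-∑ i, ‖z i‖ ^ 2)) :=
    (ENNReal.continuous_ofReal.comp (by fun_prop)).measurable
  rw [gaussian, integrable_withDensity_iff_integrable_smul' hm
    (Eventually.of_forall fun _ => ENNReal.ofReal_lt_top)]
  refine integrable_congr (Eventually.of_forall fun z => ?_)
  have h0 : 0 ≤ (Real.pi ^ d)⁻¹ * Real.exp (-∑ i, ‖z i‖ ^ 2) := by positivity
  simp only [ENNReal.toReal_ofReal h0, Complex.real_smul]

theorem integrable_exp_neg_sum_sq :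
    Integrable fun z : Fin d → ℂ => Real.exp (-∑ i, ‖z i‖ ^ 2) := by
  have h1 : Integrable fun z : ℂ => Real.exp (-‖z‖ ^ 2) := by
    have h := (GaussianFourier.integrable_cexp_neg_mul_sq_norm_add (V := ℂ) (b := 1)
      (by simp) 0 0).norm
    refine h.congr (Eventually.of_forall fun z => ?_)
    simp only [Complex.norm_exp]
    congr 1
    simp [← Complex.ofReal_pow]
  have h2 := Integrable.fintype_prod (ι := Fin d) (fun _ => h1)
  refine h2.congr (Eventually.of_forall fun z => ?_)
  simp only [← Real.exp_sum, Finset.sum_neg_distrib]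

theorem integral_exp_neg_sum_sq :
    ∫ z : Fin d → ℂ, Real.exp (-∑ i, ‖z i‖ ^ 2) = Real.pi ^ d := by
  have h1 : ∫ z : ℂ, Real.exp (-‖z‖ ^ 2) = Real.pi := by
    have h := GaussianFourier.integral_rexp_neg_mul_sq_norm (V := ℂ) one_pos
    simpa using h
  have h2 := integral_fintype_prod_volume_eq_pow (ι := Fin d) fun z : ℂ => Real.exp (-‖z‖ ^ 2)
  rw [h1, Fintype.card_fin] at h2
  rw [← h2]
  refine integral_congr_ae (Eventually.of_forall fun z => ?_)
  simp only [← Real.exp_sum, Finset.sum_neg_distrib]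

instance : IsProbabilityMeasure (gaussian d) := by
  constructor
  rw [gaussian, withDensity_apply _ MeasurableSet.univ, Measure.restrict_univ,
    ← ofReal_integral_eq_lintegral_ofReal (integrable_exp_neg_sum_sq.const_mul _)
      (Eventually.of_forall fun z => by positivity), integral_const_mul, integral_exp_neg_sum_sq,
    inv_mul_cancel₀ (by positivity), ENNReal.ofReal_one]

/-- The mean value property of entire functions with respect to the Gaussian measure. -/
theorem integral_gaussian_eq_apply_zero {f : (Fin d → ℂ) → ℂ} (hf : Differentiable ℂ f)
    (hi : Integrable f (gaussian d)) : ∫ z, f z ∂(gaussian d) = f 0 := by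
  have hrot : ∀ θ : ℝ, MeasurePreserving
      (fun z : Fin d → ℂ => Complex.exp (θ * Complex.I) • z) (gaussian d) (gaussian d) := fun θ =>
    measurePreserving_gaussian (measurePreserving_smul (Complex.norm_exp_ofReal_mul_I θ))
      fun z => by simp [Complex.norm_exp_ofReal_mul_I]
  have hemb : ∀ θ : ℝ, MeasurableEmbedding
      (fun z : Fin d → ℂ => Complex.exp (θ * Complex.I) • z) := fun θ =>
    (Homeomorph.smulOfNeZero _ (Complex.exp_ne_zero _)).measurableEmbedding
  have hcont : Continuous fun p : (Fin d → ℂ) × ℝ => f (Complex.exp (p.2 * Complex.I) • p.1) :=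
    hf.continuous.comp (by fun_prop)
  have hcirc : ∀ z : Fin d → ℂ,
      ∫ θ in Set.Ioc 0 (2 * Real.pi), f (Complex.exp (θ * Complex.I) • z) =
        (2 * Real.pi) • f 0 := by
    intro z
    have hg : Differentiable ℂ fun t : ℂ => f (t • z) := by fun_prop
    have h := (hg.diffContOnCl (s := Metric.ball (0 : ℂ) |1|)).circleAverage
    simp only [Real.circleAverage_def, circleMap, zero_add, Complex.ofReal_one, one_mul,
      zero_smul] at h
    rw [intervalIntegral.integral_of_le (by positivity)] at h
    rw [← h, smul_smul, mul_inv_cancel₀ (by positivity), one_smul]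
  have hint : Integrable (Function.uncurry fun (z : Fin d → ℂ) (θ : ℝ) =>
      f (Complex.exp (θ * Complex.I) • z))
      ((gaussian d).prod (volume.restrict (Set.Ioc 0 (2 * Real.pi)))) := by
    rw [integrable_prod_iff' (by exact hcont.aestronglyMeasurable)]
    refine ⟨Eventually.of_forall fun θ => ?_, ?_⟩
    · exact ((hrot θ).integrable_comp_emb (hemb θ)).2 hi
    · have : (fun θ : ℝ => ∫ z, ‖Function.uncurry (fun (z : Fin d → ℂ) (θ : ℝ) =>
          f (Complex.exp (θ * Complex.I) • z)) (z, θ)‖ ∂(gaussian d)) =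
          fun _ => ∫ z, ‖f z‖ ∂(gaussian d) := by
        funext θ
        exact (hrot θ).integral_comp (hemb θ) fun z => ‖f z‖
      rw [this]
      exact integrable_const _
  -- Average `f` over both the circle and the Gaussian measure. Integrating over the circle first
  -- gives `f 0`, by the one-variable mean value property; integrating over `z` first gives the
  -- integral of `f`, by rotation invariance.
  have hswap := integral_integral_swap hint
  simp only [hcirc] at hswap
  have hconst : ∀ θ : ℝ, ∫ z, f (Complex.exp (θ * Complex.I) • z) ∂(gaussian d) =
      ∫ z, f z ∂(gaussian d) := fun θ => (hrot θ).integral_comp (hemb θ) f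
  simp only [hconst, integral_const, measureReal_restrict_apply_univ, Real.volume_real_Ioc,
    probReal_univ, one_smul, sub_zero] at hswap
  rw [max_eq_left (by positivity)] at hswap
  exact (smul_right_injective ℂ (by positivity : (2 * Real.pi) ≠ 0) hswap).symm

end Gaussian

/-! ### The reproducing kernel -/

section Kernel

variable {d : ℕ}

theorem pairing_add_left (x y w : Fin d → ℂ) : pairing (x + y) w = pairing x w + pairing y w := by
  simp [pairing, add_mul, Finset.sum_add_distrib]

theorem pairing_add_right (x y w : Fin d → ℂ) : pairing w (x + y) = pairing w x + pairing w y := by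
  simp [pairing, mul_add, Finset.sum_add_distrib]

theorem conj_pairing (z w : Fin d → ℂ) : starRingEnd ℂ (pairing z w) = pairing w z := by
  simp [pairing, mul_comm]

@[simp] theorem pairing_zero_left (w : Fin d → ℂ) : pairing 0 w = 0 := by simp [pairing]

@[simp] theorem pairing_zero_right (w : Fin d → ℂ) : pairing w 0 = 0 := by simp [pairing]

theorem pairing_self (z : Fin d → ℂ) : pairing z z = ((∑ i, ‖z i‖ ^ 2 : ℝ) : ℂ) := by
  simp [pairing, Complex.mul_conj, Complex.normSq_eq_norm_sq]

theorem differentiable_pairing (w : Fin d → ℂ) : Differentiable ℂ fun z => pairing z w := by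
  unfold pairing
  fun_prop

theorem sum_norm_sq_add (z w : Fin d → ℂ) :
    ∑ i, ‖(z + w) i‖ ^ 2 = ∑ i, ‖z i‖ ^ 2 + 2 * (pairing z w).re + ∑ i, ‖w i‖ ^ 2 := by
  have h := pairing_self (z + w)
  rw [pairing_add_left, pairing_add_right, pairing_add_right, pairing_self, pairing_self,
    ← conj_pairing z w] at h
  have h2 := congrArg Complex.re h
  simp only [Complex.add_re, Complex.conj_re, Complex.ofReal_re] at h2
  linarith

/-- Weyl translation turns the weight `exp ⟨w, z⟩` into the Gaussian measure itself. -/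
theorem gaussian_density_add (f : (Fin d → ℂ) → ℂ) (z w : Fin d → ℂ) :
    (((Real.pi ^ d)⁻¹ * Real.exp (-∑ i, ‖(z + w) i‖ ^ 2) : ℝ) : ℂ) *
        (f (z + w) * Complex.exp (pairing w (z + w))) =
      (((Real.pi ^ d)⁻¹ * Real.exp (-∑ i, ‖z i‖ ^ 2) : ℝ) : ℂ) *
        (f (z + w) * Complex.exp (-pairing z w)) := by
  have h : ((-∑ i, ‖(z + w) i‖ ^ 2 : ℝ) : ℂ) =
      ((-∑ i, ‖z i‖ ^ 2 : ℝ) : ℂ) - pairing z w - pairing w (z + w) := by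
    rw [← conj_pairing (z + w) w, pairing_add_left, map_add, pairing_self, sum_norm_sq_add]
    have h2 : ((2 * (pairing z w).re : ℝ) : ℂ) = pairing z w + starRingEnd ℂ (pairing z w) := by
      rw [Complex.add_conj]
    push_cast at h2 ⊢
    simp only [map_sum, map_pow, Complex.conj_ofReal]
    linear_combination -h2
  simp only [Complex.ofReal_mul, Complex.ofReal_exp, h, Complex.exp_sub, Complex.exp_neg]
  have := Complex.exp_ne_zero (pairing w (z + w))
  field_simp

theorem memFock_kernel (w : Fin d → ℂ) : MemFock fun z => Complex.exp (pairing z w) := by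
  have hd : Differentiable ℂ fun z => Complex.exp (pairing z w) := (differentiable_pairing w).cexp
  refine ⟨hd, ?_⟩
  rw [memLp_two_iff_integrable_sq_norm hd.continuous.aestronglyMeasurable]
  have h1 : Integrable (fun z : Fin d → ℂ => ((‖Complex.exp (pairing z w)‖ ^ 2 : ℝ) : ℂ))
      (gaussian d) := by
    rw [integrable_gaussian_iff]
    -- Completing the square: `|exp⟨z, w⟩|² exp(-|z|²) = exp(|w|²) exp(-|z - w|²)`.
    have h2 : Integrable fun z : Fin d → ℂ =>
        (((Real.pi ^ d)⁻¹ * Real.exp (∑ i, ‖w i‖ ^ 2)) *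
          Real.exp (-∑ i, ‖(z + -w) i‖ ^ 2) : ℝ) :=
      (integrable_exp_neg_sum_sq.comp_add_right (-w)).const_mul _
    refine h2.ofReal.congr (Eventually.of_forall fun z => ?_)
    have h3 : (pairing z (-w)).re = -(pairing z w).re := by simp [pairing]
    simp only [Complex.norm_exp, ← Complex.ofReal_mul, RCLike.ofReal_mul]
    rw [sum_norm_sq_add, h3, ← Real.exp_nat_mul]
    simp only [Complex.coe_algebraMap, ← Complex.ofReal_mul, mul_assoc, ← Real.exp_add]
    congr 3
    simp
    ring
  exact h1.re

/-- The reproducing kernel `K_w(z) = exp ⟨z, w⟩`. -/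
def kernel (w : Fin d → ℂ) : FockSpace d := FockSpace.mk _ (memFock_kernel w)

@[simp] theorem kernel_apply (w z : Fin d → ℂ) : kernel w z = Complex.exp (pairing z w) := rfl

/-- Substituting `z + w` for `z` moves the evaluation point to the origin, where the Gaussian mean
value property applies to `f(z + w) exp(-⟨z, w⟩)`. -/
theorem inner_kernel (f : FockSpace d) (w : Fin d → ℂ) : inner ℂ (kernel w) f = f w := by
  have hf := f.memFock.1
  have hconj : ∀ z, starRingEnd ℂ (kernel w z) = Complex.exp (pairing w z) := fun z => by
    rw [kernel_apply, ← Complex.exp_conj, conj_pairing]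
  have hint : Integrable (fun z => f z * Complex.exp (pairing w z)) (gaussian d) := by
    have h : Integrable (fun z => f z * starRingEnd ℂ (kernel w z)) (gaussian d) :=
      f.memFock.2.integrable_mul (kernel w).memFock.2.star
    simpa only [hconj] using h
  have hd : Differentiable ℂ fun z => f (z + w) * Complex.exp (-pairing z w) :=
    Differentiable.mul (by fun_prop) (differentiable_pairing w).neg.cexp
  have hint2 : Integrable (fun z => f (z + w) * Complex.exp (-pairing z w)) (gaussian d) := by
    rw [integrable_gaussian_iff] at hint ⊢
    refine (hint.comp_add_right w).congr (Eventually.of_forall fun z => ?_)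
    exact gaussian_density_add f z w
  rw [FockSpace.inner_def]
  simp only [hconj]
  have hmv := integral_gaussian_eq_apply_zero hd hint2
  simp only [zero_add, pairing_zero_left, neg_zero, Complex.exp_zero, mul_one] at hmv
  rw [← hmv, integral_gaussian, integral_gaussian, ← integral_add_right_eq_self _ w]
  exact integral_congr_ae (Eventually.of_forall fun z => gaussian_density_add f z w)

theorem norm_kernel_sq (w : Fin d → ℂ) : ‖kernel w‖ ^ 2 = Real.exp (∑ i, ‖w i‖ ^ 2) := by
  rw [← inner_self_eq_norm_sq (𝕜 := ℂ), inner_kernel, kernel_apply, pairing_self,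
    ← Complex.ofReal_exp]
  rfl

theorem norm_apply_le (f : FockSpace d) (w : Fin d → ℂ) :
    ‖f w‖ ≤ ‖f‖ * Real.exp ((∑ i, ‖w i‖ ^ 2) / 2) := by
  have h2 : ‖kernel w‖ = Real.exp ((∑ i, ‖w i‖ ^ 2) / 2) := by
    rw [← Real.sqrt_sq (norm_nonneg (kernel w)), norm_kernel_sq, Real.exp_half]
  rw [← inner_kernel f w, ← h2, mul_comm]
  exact norm_inner_le_norm _ _

end Kernel

/-! ### The symbols of symmetric weighted composition operators -/

section Symbols

variable {H : Type*} [NormedAddCommGroup H] [InnerProductSpace ℂ H] [CompleteSpace H]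

/-- `S = ε S*` with `S` densely defined. -/
def IsEpsSymmetric (ε : ℂ) (S : H →ₗ.[ℂ] H) : Prop :=
  Dense (S.domain : Set H) ∧ S = ε • S.adjoint

theorem IsRealSymmetric.isEpsSymmetric {S : H →ₗ.[ℂ] H} (h : IsRealSymmetric S) :
    IsEpsSymmetric 1 S :=
  ⟨h.1, by rw [one_smul]; exact h.2⟩

theorem IsSkewRealSymmetric.isEpsSymmetric {S : H →ₗ.[ℂ] H} (h : IsSkewRealSymmetric S) :
    IsEpsSymmetric (-1) S := by
  refine ⟨h.1, h.2.trans ?_⟩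
  refine LinearPMap.ext rfl fun x hx hx' => ?_
  simp

namespace IsEpsSymmetric

variable {ε : ℂ} {S : H →ₗ.[ℂ] H}

theorem mem_domain_iff (h : IsEpsSymmetric ε S) (x : H) :
    x ∈ S.domain ↔ x ∈ S.adjoint.domain := by
  conv_lhs => rw [h.2]
  rfl

theorem apply_eq (h : IsEpsSymmetric ε S) {x : H} (hx : x ∈ S.domain)
    (hx' : x ∈ S.adjoint.domain) : S ⟨x, hx⟩ = ε • S.adjoint ⟨x, hx'⟩ :=
  h.2.le.2 (x := ⟨x, hx⟩) (y := ⟨x, hx'⟩) rfl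

/-- The hypothesis says that `S* x = y`. This is how vectors are shown to lie in the domain of `S`,
about which nothing explicit is known. -/
theorem exists_apply_eq (h : IsEpsSymmetric ε S) {x y : H}
    (hxy : ∀ u : S.domain, inner ℂ y (u : H) = inner ℂ x (S u)) :
    ∃ hx : x ∈ S.domain, S ⟨x, hx⟩ = ε • y := by
  have hx' := S.mem_adjoint_domain_of_exists x ⟨y, hxy⟩
  refine ⟨(h.mem_domain_iff x).2 hx', ?_⟩
  rw [h.apply_eq _ hx', LinearPMap.adjoint_apply_eq h.1 ⟨x, hx'⟩ hxy]

theorem isClosed (h : IsEpsSymmetric ε S) (hε : ε = 1 ∨ ε = -1) : S.IsClosed := by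
  have h1 : S.adjoint.IsClosed := LinearPMap.adjoint_isClosed h.1
  rcases hε with rfl | rfl
  · rw [h.2, one_smul]; exact h1
  · rw [LinearPMap.IsClosed] at h1 ⊢
    have h2 : (S.graph : Set (H × H)) =
        (fun p : H × H => (p.1, -p.2)) ⁻¹' (S.adjoint.graph : Set (H × H)) := by
      ext ⟨x, y⟩
      simp only [SetLike.mem_coe, Set.mem_preimage, LinearPMap.mem_graph_iff]
      constructor
      · rintro ⟨u, rfl, rfl⟩
        refine ⟨⟨u, (h.mem_domain_iff _).1 u.2⟩, rfl, ?_⟩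
        rw [h.apply_eq u.2 ((h.mem_domain_iff _).1 u.2)]
        simp
      · rintro ⟨u, rfl, hu⟩
        refine ⟨⟨u, (h.mem_domain_iff _).2 u.2⟩, rfl, ?_⟩
        rw [h.apply_eq _ u.2]
        simpa [neg_eq_iff_eq_neg] using hu
    rw [h2]
    exact h1.preimage (by fun_prop)

end IsEpsSymmetric

variable {d : ℕ} {ψ : (Fin d → ℂ) → ℂ} {φ : (Fin d → ℂ) → (Fin d → ℂ)}
  {S : FockSpace d →ₗ.[ℂ] FockSpace d} {ε : ℂ}

theorem IsWCO.apply (hS : IsWCO ψ φ S) (u : S.domain) (z : Fin d → ℂ) :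
    S u z = ψ z * u.1 (φ z) := by
  rw [hS.2 (x := u) (y := ⟨u, hS.1 u.2⟩) rfl]
  rfl

theorem IsWCO.kernel_identity (hS : IsWCO ψ φ S) (h : IsEpsSymmetric ε S) (z w : Fin d → ℂ) :
    ψ z * Complex.exp (pairing (φ z) w) =
      ε * (starRingEnd ℂ (ψ w) * Complex.exp (pairing z (φ w))) := by
  obtain ⟨hx, he⟩ := h.exists_apply_eq (x := kernel w)
    (y := starRingEnd ℂ (ψ w) • kernel (φ w)) fun u => by
      rw [inner_smul_left, inner_kernel, inner_kernel, hS.apply, Complex.conj_conj]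
  have h1 := hS.apply ⟨_, hx⟩ z
  rw [he] at h1
  exact h1.symm

/-- Differentiating `exp ∘ h = 1` gives `h' = 0`, so no choice of logarithm is needed. -/
theorem eq_zero_of_exp_eq_one {h : (Fin d → ℂ) → ℂ} (hd : Differentiable ℂ h)
    (he : ∀ z, Complex.exp (h z) = 1) (h0 : h 0 = 0) (z : Fin d → ℂ) : h z = 0 := by
  rw [← h0]
  refine is_const_of_fderiv_eq_zero (𝕜 := ℂ) hd (fun x => ?_) z 0
  have h1 : HasFDerivAt (fun z => Complex.exp (h z)) (Complex.exp (h x) • fderiv ℂ h x) x :=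
    (hd x).hasFDerivAt.cexp
  simp only [he, one_smul] at h1
  exact h1.unique (hasFDerivAt_const 1 x)

theorem pairing_mulVec_right (A : Matrix (Fin d) (Fin d) ℂ) (z w : Fin d → ℂ) :
    pairing z (A.mulVec w) = pairing (A.conjTranspose.mulVec z) w := by
  have h : ∀ x y : Fin d → ℂ, pairing x y = dotProduct x (star y) := fun _ _ => rfl
  rw [h, h, Matrix.star_mulVec, dotProduct_comm, ← Matrix.dotProduct_mulVec, dotProduct_comm]

theorem pairing_mulVec_left (A : Matrix (Fin d) (Fin d) ℂ) (z w : Fin d → ℂ) :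
    pairing (A.mulVec z) w = pairing z (A.conjTranspose.mulVec w) := by
  rw [pairing_mulVec_right, Matrix.conjTranspose_conjTranspose]

/-- The symbols of a (skew-)real symmetric weighted composition operator. -/
theorem IsWCO.exists_symbols (hS : IsWCO ψ φ S) (h : IsEpsSymmetric ε S)
    (hψ0 : ψ ≠ 0) (hφ : Differentiable ℂ φ) :
    ∃ (α : ℂ) (Q : Matrix (Fin d) (Fin d) ℂ) (q : Fin d → ℂ), α ≠ 0 ∧
      α = ε * starRingEnd ℂ α ∧ Q.IsHermitian ∧
      (∀ z, ψ z = α * Complex.exp (pairing z q)) ∧ ∀ z, φ z = Q.mulVec z + q := by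
  have key := hS.kernel_identity h
  set q := φ 0
  set α := ψ 0
  have hα : α = ε * starRingEnd ℂ α := by simpa using key 0 0
  have hψ1 : ∀ z, ψ z = α * Complex.exp (pairing z q) := fun z => by
    rw [hα, mul_assoc]
    simpa using key z 0
  have hα0 : α ≠ 0 := fun h0 => hψ0 (funext fun z => by rw [hψ1, h0, zero_mul]; rfl)
  -- After cancelling `α` the kernel identity equates two exponentials. The difference of their
  -- exponents is holomorphic in `z`, for fixed `w`, and vanishes at `z = 0`.
  have hsym : ∀ z w, pairing (φ z - q) w = pairing z (φ w - q) := by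
    intro z w
    have hd : Differentiable ℂ fun z =>
        pairing z q + pairing (φ z) w - pairing q w - pairing z (φ w) :=
      (((differentiable_pairing q).add ((differentiable_pairing w).comp hφ)).sub_const _).sub
        (differentiable_pairing _)
    have h1 := eq_zero_of_exp_eq_one hd (fun z => ?_) (by simp [q]) z
    · have h2 : ∀ x y w : Fin d → ℂ, pairing (x - y) w = pairing x w - pairing y w := by
        simp [pairing, sub_mul]
      have h3 : ∀ x y w : Fin d → ℂ, pairing w (x - y) = pairing w x - pairing w y := by
        simp [pairing, mul_sub]
      rw [h2, h3]
      linear_combination h1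
    · have h1 := key z w
      rw [hψ1, hψ1, map_mul, ← Complex.exp_conj, conj_pairing, mul_assoc, ← Complex.exp_add,
        mul_assoc, ← Complex.exp_add, ← mul_assoc, ← hα] at h1
      rw [sub_sub, Complex.exp_sub, mul_left_cancel₀ hα0 h1, div_self (Complex.exp_ne_zero _)]
  have hpair : ∀ (z : Fin d → ℂ) (i : Fin d), pairing z (Pi.single i 1) = z i := fun z i => by
    simp [pairing, Pi.single_apply, apply_ite]
  have hpair' : ∀ (z : Fin d → ℂ) (i : Fin d),
      pairing (Pi.single i 1) z = starRingEnd ℂ (z i) := fun z i => by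
    simp [pairing, Pi.single_apply]
  -- `hsym` at the basis vector `e_i` gives `(φ(z) - q)_i = ⟨z, φ(e_i) - q⟩`, which is linear in
  -- `z`; its coefficients form row `i` of `Q`.
  refine ⟨α, Matrix.of fun i j => starRingEnd ℂ ((φ (Pi.single i 1) - q) j), q, hα0, hα, ?_, hψ1,
    fun z => ?_⟩
  · ext i j
    have h1 := hsym (Pi.single i 1) (Pi.single j 1)
    rw [hpair, hpair'] at h1
    simp only [Matrix.conjTranspose_apply, Matrix.of_apply, RCLike.star_def]
    rw [h1, Complex.conj_conj]
  · refine eq_add_of_sub_eq (funext fun i => ?_)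
    have h1 := hsym z (Pi.single i 1)
    rw [hpair] at h1
    rw [h1]
    simp [Matrix.mulVec, dotProduct, pairing, mul_comm]

end Symbols

/-! ### Uniqueness for the functional equation of the deficiency spaces -/

section Uniqueness

/-- Liouville's theorem for entire functions changing sign under the shift by `1`. -/
theorem eq_zero_of_antiperiodic {F : ℂ → ℂ} (hF : Differentiable ℂ F)
    (hper : ∀ s, F (s + 1) = -F s) {B : ℝ}
    (hB : ∀ s : ℂ, 0 ≤ s.re → s.re ≤ 1 → ‖F s‖ ≤ B) (s : ℂ) : F s = 0 := by
  have hn : Function.Periodic (fun s => ‖F s‖) 1 := fun s => by simp [hper]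
  -- Subtracting the integer part of `s.re` moves `s` into the strip where the bound is known.
  have hb : ∀ s, ‖F s‖ ≤ B := fun s => by
    have h1 := hn.sub_zsmul_eq (x := s) ⌊s.re⌋
    rw [← h1]
    refine hB _ ?_ ?_
    · simp
    · simpa using (Int.fract_lt_one s.re).le
  have hc := hF.apply_eq_apply_of_bounded
    (isBounded_iff_forall_norm_le.2 ⟨B, by rintro _ ⟨s, rfl⟩; exact hb s⟩) (s + 1) s
  rw [hper] at hc
  exact self_eq_neg.1 hc.symm

/-- The complex orbit through `z` of the affine map `z ↦ p z + r`, with a cocycle `e` over it. -/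
theorem exists_orbit (p : ℝ) (hp : 0 ≤ p) (r z : ℂ) (hz : p = 0 → z = r) :
    ∃ (g e : ℂ → ℂ) (R B : ℝ), Differentiable ℂ g ∧ Differentiable ℂ e ∧ g 0 = z ∧
      (∀ s, g (s + 1) = p * g s + r) ∧
      (∀ s, e (s + 1) = e s + g s * starRingEnd ℂ r - R) ∧
      ∀ s : ℂ, 0 ≤ s.re → s.re ≤ 1 → ‖g s‖ ^ 2 / 2 + (e s).re ≤ B := by
  by_cases h1 : p = 1
  · subst h1
    refine ⟨fun s => z + s * r,
      fun s => s * z * starRingEnd ℂ r + (s ^ 2 - s) / 2 * (r * starRingEnd ℂ r), 0,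
      ‖z‖ ^ 2 / 2 + ‖r‖ ^ 2 + 2 * |(z * starRingEnd ℂ r).re|, by fun_prop, by fun_prop, by simp,
      fun s => by push_cast; ring, fun s => by push_cast; ring, fun s hs0 hs1 => ?_⟩
    -- The imaginary part of `s` cancels between `|g|²/2` and `Re e`, so the bound is uniform along
    -- the vertical direction of the strip.
    have e1 : ‖z + s * r‖ ^ 2 / 2 + (s * z * starRingEnd ℂ r +
        (s ^ 2 - s) / 2 * (r * starRingEnd ℂ r)).re =
        ‖z‖ ^ 2 / 2 + (s.re ^ 2 - s.re / 2) * ‖r‖ ^ 2 +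
          2 * (s.re * (z * starRingEnd ℂ r).re) := by
      simp only [← Complex.normSq_eq_norm_sq, Complex.normSq_apply, Complex.add_re,
        Complex.add_im, Complex.mul_re, Complex.mul_im, Complex.conj_re, Complex.conj_im,
        Complex.sub_re, Complex.sub_im, Complex.div_ofNat_re, Complex.div_ofNat_im, pow_two s]
      ring
    rw [e1]
    have h2 : s.re * (z * starRingEnd ℂ r).re ≤ |(z * starRingEnd ℂ r).re| := by
      have := le_abs_self (z * starRingEnd ℂ r).re
      have := abs_nonneg (z * starRingEnd ℂ r).re
      nlinarith
    have h3 : (s.re ^ 2 - s.re / 2) * ‖r‖ ^ 2 ≤ 1 * ‖r‖ ^ 2 := by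
      gcongr
      nlinarith
    linarith
  · have hp1 : (1 - p : ℂ) ≠ 0 := by
      rw [sub_ne_zero]
      exact_mod_cast Ne.symm h1
    -- The fixed point of the affine map; the orbit is `z0 + p^s (z - z0)`.
    obtain ⟨z0, hz0⟩ : ∃ z0 : ℂ, r = (1 - p) * z0 := ⟨r / (1 - p), by field_simp⟩
    -- For `p = 0` the value `Real.log 0 = 0` is harmless: then `z = r = z0`, and the orbit is
    -- constant.
    have hexp : Complex.exp (Real.log p) * (z - z0) = p * (z - z0) := by
      rcases hp.eq_or_lt with h0 | h0
      · have : z - z0 = 0 := by rw [hz h0.symm, hz0, ← h0]; simp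
        simp [this]
      · rw [← Complex.ofReal_exp, Real.exp_log h0]
    have hexp' : ∀ s : ℂ, Complex.exp ((s + 1) * Real.log p) * (z - z0) =
        p * (Complex.exp (s * Real.log p) * (z - z0)) := fun s => by
      rw [add_mul, one_mul, Complex.exp_add, mul_assoc, hexp]
      ring
    have hR : ((Complex.normSq z0 * (1 - p) : ℝ) : ℂ) = z0 * starRingEnd ℂ z0 * (1 - p) := by
      rw [Complex.mul_conj]
      push_cast
      rfl
    have hrc : starRingEnd ℂ r = (1 - p) * starRingEnd ℂ z0 := by rw [hz0]; simp
    refine ⟨fun s => z0 + Complex.exp (s * Real.log p) * (z - z0),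
      fun s => -(Complex.exp (s * Real.log p) * (z - z0) * starRingEnd ℂ z0),
      Complex.normSq z0 * (1 - p),
      ‖z0‖ ^ 2 / 2 + (Real.exp |Real.log p| * ‖z - z0‖) ^ 2 / 2, by fun_prop, by fun_prop,
      by simp, fun s => ?_, fun s => ?_, fun s hs0 hs1 => ?_⟩
    · simp only [hexp']
      rw [hz0]
      ring
    · simp only [hexp', hR, hrc]
      ring
    -- The cocycle cancels the cross term of `|z0 + b|²/2`, and the modulus of `b = p^s (z - z0)`
    -- depends only on `s.re`.
    · have e1 : ∀ a b : ℂ, ‖a + b‖ ^ 2 / 2 + (-(b * starRingEnd ℂ a)).re =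
          ‖a‖ ^ 2 / 2 + ‖b‖ ^ 2 / 2 := fun a b => by
        simp only [← Complex.normSq_eq_norm_sq, Complex.normSq_apply, Complex.add_re,
          Complex.add_im, Complex.mul_re, Complex.conj_re, Complex.conj_im, Complex.neg_re]
        ring
      rw [e1]
      have h2 : ‖Complex.exp (s * Real.log p) * (z - z0)‖ ≤
          Real.exp |Real.log p| * ‖z - z0‖ := by
        rw [norm_mul, Complex.norm_exp]
        gcongr
        rw [Complex.re_mul_ofReal]
        have := le_abs_self (Real.log p)
        have := abs_nonneg (Real.log p)
        nlinarith
      gcongr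

variable {d : ℕ}

/-- The equation decouples into one-dimensional orbits, one per coordinate, run with a common
complex time. The minus sign is essential: it makes the resulting bounded function antiperiodic, so
that being constant forces it to vanish. -/
theorem eq_zero_of_functional_equation_diagonal {h : (Fin d → ℂ) → ℂ} (hd : Differentiable ℂ h)
    {C : ℝ} (hC : ∀ z, ‖h z‖ ≤ C * Real.exp ((∑ i, ‖z i‖ ^ 2) / 2))
    {p : Fin d → ℝ} (hp : ∀ i, 0 ≤ p i) {r : Fin d → ℂ} {κ : ℝ} (hκ : 0 < κ)
    (heq : ∀ z, h z = -(κ * Complex.exp (pairing z r) * h fun i => p i * z i + r i))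
    (z : Fin d → ℂ) : h z = 0 := by
  have hC0 : 0 ≤ C :=
    nonneg_of_mul_nonneg_left ((norm_nonneg _).trans (hC 0)) (Real.exp_pos _)
  -- A coordinate with `p i = 0` collapses to `r i` after one step, so only such points lie on a
  -- complex orbit. One use of the equation reaches them from any `z`.
  suffices hmain : ∀ z : Fin d → ℂ, (∀ i, p i = 0 → z i = r i) → h z = 0 by
    rw [heq, hmain _ fun i hi => by simp [hi]]
    simp
  intro z hz
  choose g e R B hg he hg0 hg1 he1 hB using fun i => exists_orbit (p i) (hp i) (r i) (z i) (hz i)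
  -- `exp L` absorbs `κ` and the constants `R i`. As `L` is real, `|exp(s L)|` depends only on
  -- `s.re`.
  set L : ℝ := Real.log κ + ∑ i, R i
  set F : ℂ → ℂ := fun s => h (fun i => g i s) * Complex.exp (∑ i, e i s) *
    Complex.exp (s * L)
  have hFd : Differentiable ℂ F := by
    have h1 : Differentiable ℂ fun s => h fun i => g i s :=
      hd.comp (differentiable_pi.2 hg)
    have h2 : Differentiable ℂ fun s => ∑ i, e i s := by fun_prop
    fun_prop
  have hF1 : ∀ s, F (s + 1) = -F s := by
    intro s
    have h1 := heq fun i => g i s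
    simp only [← hg1] at h1
    have h2 : ∑ i, e i (s + 1) = ∑ i, e i s + pairing (fun i => g i s) r - ∑ i, (R i : ℂ) := by
      simp only [he1, Finset.sum_sub_distrib, Finset.sum_add_distrib, pairing]
    have hκ' : (κ : ℂ) ≠ 0 := by exact_mod_cast hκ.ne'
    have h3 : Complex.exp ((s + 1) * L) =
        Complex.exp (s * L) * (κ * Complex.exp (∑ i, (R i : ℂ))) := by
      have hlog : Complex.exp (Real.log κ) = κ := by rw [← Complex.ofReal_exp, Real.exp_log hκ]
      rw [add_mul, one_mul, Complex.exp_add]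
      simp only [L]
      push_cast
      rw [Complex.exp_add, hlog]
    simp only [F]
    rw [h1, h2, h3, Complex.exp_sub, Complex.exp_add]
    have := Complex.exp_ne_zero (∑ i, (R i : ℂ))
    field_simp
  have hFB : ∀ s : ℂ, 0 ≤ s.re → s.re ≤ 1 → ‖F s‖ ≤ C * Real.exp (∑ i, B i + |L|) := by
    intro s hs0 hs1
    have h1 : (s * L).re ≤ |L| := by
      rw [Complex.re_mul_ofReal]
      have := le_abs_self L
      have := abs_nonneg L
      nlinarith
    have h2 : (∑ i, ‖g i s‖ ^ 2) / 2 + (∑ i, e i s).re ≤ ∑ i, B i := by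
      rw [Complex.re_sum, Finset.sum_div, ← Finset.sum_add_distrib]
      exact Finset.sum_le_sum fun i _ => hB i s hs0 hs1
    simp only [F]
    rw [norm_mul, norm_mul, Complex.norm_exp, Complex.norm_exp]
    calc _ ≤ C * Real.exp ((∑ i, ‖g i s‖ ^ 2) / 2) * Real.exp (∑ i, e i s).re *
          Real.exp (s * L).re := by gcongr; exact hC _
      _ = C * Real.exp ((∑ i, ‖g i s‖ ^ 2) / 2 + (∑ i, e i s).re + (s * L).re) := by
          rw [Real.exp_add, Real.exp_add]; ring
      _ ≤ _ := by gcongr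
  have h0 := eq_zero_of_antiperiodic hFd hF1 hFB 0
  simpa [F, hg0] using h0

theorem sum_norm_sq_mulVec {V : Matrix (Fin d) (Fin d) ℂ}
    (hV : V ∈ Matrix.unitaryGroup (Fin d) ℂ) (z : Fin d → ℂ) :
    ∑ i, ‖V.mulVec z i‖ ^ 2 = ∑ i, ‖z i‖ ^ 2 := by
  have h : pairing (V.mulVec z) (V.mulVec z) = pairing z z := by
    rw [pairing_mulVec_left, Matrix.mulVec_mulVec, ← Matrix.star_eq_conjTranspose,
      Matrix.mem_unitaryGroup_iff'.1 hV, Matrix.one_mulVec]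
  rw [pairing_self, pairing_self] at h
  exact_mod_cast h

/-- If `ψ · (f ∘ φ)` is symmetric up to the sign `ε`, its square has no eigenvalue `-ε`. -/
theorem eq_zero_of_apply_apply_eq {α ε : ℂ} (hε : ε = 1 ∨ ε = -1) (hα0 : α ≠ 0)
    (hα : α = ε * starRingEnd ℂ α) {V : Matrix (Fin d) (Fin d) ℂ}
    (hV : V ∈ Matrix.unitaryGroup (Fin d) ℂ) {m : Fin d → ℝ} {q : Fin d → ℂ}
    {ψ : (Fin d → ℂ) → ℂ} {φ : (Fin d → ℂ) → (Fin d → ℂ)}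
    (hψ : ∀ z, ψ z = α * Complex.exp (pairing z q))
    (hφ : ∀ z, φ z =
      (V * Matrix.diagonal (fun i => (m i : ℂ)) * V.conjTranspose).mulVec z + q)
    (h : FockSpace d) (heq : ∀ z, -ε * h z = ψ z * (ψ (φ z) * h (φ (φ z)))) : h = 0 := by
  have hVV : V.conjTranspose * V = 1 := Matrix.mem_unitaryGroup_iff'.1 hV
  have hVV' : V * V.conjTranspose = 1 := Matrix.mem_unitaryGroup_iff.1 hV
  set u := V.conjTranspose.mulVec q
  have hq : q = V.mulVec u := by rw [Matrix.mulVec_mulVec, hVV', Matrix.one_mulVec]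
  have hφV : ∀ x, φ (V.mulVec x) = V.mulVec fun i => m i * x i + u i := fun x => by
    have h1 : (fun i => (m i : ℂ) * x i + u i) =
        (Matrix.diagonal (fun i => (m i : ℂ))).mulVec x + u := by
      ext i
      simp [Matrix.mulVec_diagonal]
    rw [hφ, h1, Matrix.mulVec_add, ← hq, Matrix.mulVec_mulVec, Matrix.mulVec_mulVec, mul_assoc,
      hVV, mul_one]
  have hψV : ∀ x, ψ (V.mulVec x) = α * Complex.exp (pairing x u) := fun x => by
    rw [hψ, pairing_mulVec_left]
  -- The sign `ε` in `α²` cancels the one in `-ε h`, so that the functional equation has coefficient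
  -- `-κ` with `κ > 0` in both cases.
  have hα2 : α * α = ε * (‖α‖ ^ 2 : ℝ) := by
    nth_rw 2 [hα]
    rw [mul_left_comm, Complex.mul_conj, Complex.normSq_eq_norm_sq]
  have hεε : ε * ε = 1 := by rcases hε with rfl | rfl <;> simp
  have hg : ∀ x, h (V.mulVec x) = 0 := by
    refine eq_zero_of_functional_equation_diagonal (h := fun x => h (V.mulVec x))
      (C := ‖h‖) (p := fun i => m i ^ 2) (r := fun i => (1 + m i) * u i)
      (κ := ‖α‖ ^ 2 * Real.exp (∑ i, ‖u i‖ ^ 2))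
      (h.memFock.1.comp (Matrix.mulVecLin V).toContinuousLinearMap.differentiable)
      (fun z => ?_) (fun i => sq_nonneg _) (by positivity) fun x => ?_
    · have := norm_apply_le h (V.mulVec z)
      rwa [sum_norm_sq_mulVec hV] at this
    · have h1 := heq (V.mulVec x)
      rw [hφV, hφV, hψV, hψV] at h1
      have h2 : (fun i => (m i : ℂ) * (m i * x i + u i) + u i) =
          fun i => ((m i ^ 2 : ℝ) : ℂ) * x i + (1 + m i) * u i := by
        funext i
        push_cast
        ring
      have h3 : pairing x u + pairing (fun i => m i * x i + u i) u =
          ((∑ i, ‖u i‖ ^ 2 : ℝ) : ℂ) + pairing x fun i => (1 + m i) * u i := by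
        rw [← pairing_self]
        simp only [pairing, ← Finset.sum_add_distrib]
        refine Finset.sum_congr rfl fun i _ => ?_
        simp
        ring
      rw [h2] at h1
      have h4 : Complex.exp (pairing x u) * Complex.exp (pairing (fun i => m i * x i + u i) u) =
          Complex.exp ((∑ i, ‖u i‖ ^ 2 : ℝ) : ℂ) *
            Complex.exp (pairing x fun i => (1 + m i) * u i) := by
        rw [← Complex.exp_add, h3, Complex.exp_add]
      rw [Complex.ofReal_mul, Complex.ofReal_exp]
      set a := h fun i => ((m i ^ 2 : ℝ) : ℂ) * x i + (1 + m i) * u i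
      generalize h (V.mulVec fun i => ((m i ^ 2 : ℝ) : ℂ) * x i + (1 + m i) * u i) = b at h1 ⊢
      generalize h (V.mulVec x) = c at h1 ⊢
      linear_combination (-ε) * h1 - c * hεε + (-ε) * b * α * α * h4 +
        (-ε) * b * Complex.exp ((∑ i, ‖u i‖ ^ 2 : ℝ) : ℂ) *
            Complex.exp (pairing x fun i => (1 + m i) * u i) * hα2 -
        b * Complex.exp ((∑ i, ‖u i‖ ^ 2 : ℝ) : ℂ) *
            Complex.exp (pairing x fun i => (1 + m i) * u i) * (‖α‖ ^ 2 : ℝ) * hεε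
  refine FockSpace.ext fun z => ?_
  have := hg (V.conjTranspose.mulVec z)
  rwa [Matrix.mulVec_mulVec, hVV', Matrix.one_mulVec] at this

end Uniqueness

/-! ### Maximality of symmetric weighted composition operators -/

section Maximality

/-- Orthogonal decomposition of a pair of vectors along the graph of a symmetric operator. -/
theorem IsEpsSymmetric.exists_graph_decomposition {H : Type*} [NormedAddCommGroup H]
    [InnerProductSpace ℂ H] [CompleteSpace H] {ε : ℂ} {S : H →ₗ.[ℂ] H}
    (h : IsEpsSymmetric ε S) (hε : ε = 1 ∨ ε = -1) (f y : H) :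
    ∃ (g : S.domain) (hk : y - S g ∈ S.domain), S ⟨y - S g, hk⟩ = -ε • (f - (g : H)) := by
  -- The graph is placed in the Hilbert direct sum, so that orthogonal projection is available;
  -- orthogonality to it says `S*(y - S g) = -(f - g)`.
  set G : Submodule ℂ (WithLp 2 (H × H)) :=
    S.graph.comap (WithLp.linearEquiv 2 ℂ (H × H)).toLinearMap
  have hG : IsClosed (G : Set (WithLp 2 (H × H))) :=
    (h.isClosed hε).preimage (WithLp.prod_continuous_ofLp 2 H H)
  have : CompleteSpace G := hG.completeSpace_coe
  set v : WithLp 2 (H × H) := WithLp.toLp 2 (f, y)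
  have h1 : G.starProjection v ∈ G := G.starProjection_apply_mem v
  have h2 := G.sub_starProjection_mem_orthogonal v
  obtain ⟨g, hg1, hg2⟩ := (LinearPMap.mem_graph_iff S).1 h1
  obtain ⟨hk, he⟩ := h.exists_apply_eq (x := y - S g) (y := -(f - (g : H))) fun u => by
    have h3 : WithLp.toLp 2 ((u : H), S u) ∈ G := S.mem_graph u
    have h4 := (Submodule.mem_orthogonal' G _).1 h2 _ h3
    rw [WithLp.prod_inner_apply] at h4
    have e1 : (v - G.starProjection v).ofLp.1 = f - g := by rw [hg1]; rfl
    have e2 : (v - G.starProjection v).ofLp.2 = y - S g := by rw [hg2]; rfl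
    rw [e1, e2] at h4
    rw [inner_neg_left]
    exact neg_eq_of_add_eq_zero_right h4
  exact ⟨g, hk, by rw [he, smul_neg, neg_smul]⟩

variable {d : ℕ} {ψ : (Fin d → ℂ) → ℂ} {φ : (Fin d → ℂ) → (Fin d → ℂ)}
  {S : FockSpace d →ₗ.[ℂ] FockSpace d} {ε : ℂ}

/-- The projection remainder `h = f - g` satisfies `E h = E f - S g`, which is in the domain of `S`;
a second application gives `E (E h) = -ε h`, hence `h = 0` and `f = g`. -/
theorem IsWCO.mem_domain_iff (hS : IsWCO ψ φ S) (h : IsEpsSymmetric ε S) (hε : ε = 1 ∨ ε = -1)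
    {α : ℂ} (hα0 : α ≠ 0) (hα : α = ε * starRingEnd ℂ α) {V : Matrix (Fin d) (Fin d) ℂ}
    (hV : V ∈ Matrix.unitaryGroup (Fin d) ℂ) {m : Fin d → ℝ} {q : Fin d → ℂ}
    (hψ : ∀ z, ψ z = α * Complex.exp (pairing z q))
    (hφ : ∀ z, φ z =
      (V * Matrix.diagonal (fun i => (m i : ℂ)) * V.conjTranspose).mulVec z + q)
    (f : FockSpace d) : f ∈ S.domain ↔ MemFock (wcExpr ψ φ f) := by
  refine ⟨fun hf => hS.1 hf, fun hf => ?_⟩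
  obtain ⟨g, hk, he⟩ := h.exists_graph_decomposition hε f (FockSpace.mk _ hf)
  have hk1 : ∀ z, (FockSpace.mk _ hf - S g) z = ψ z * (f - (g : FockSpace d)) (φ z) := fun z => by
    rw [FockSpace.sub_apply, FockSpace.mk_apply, hS.apply, FockSpace.sub_apply, wcExpr, mul_sub]
  have h0 : f - (g : FockSpace d) = 0 := by
    refine eq_zero_of_apply_apply_eq hε hα0 hα hV hψ hφ _ fun z => ?_
    rw [← hk1, ← FockSpace.smul_apply, ← he, hS.apply]
  rw [sub_eq_zero.1 h0]
  exact g.2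

end Maximality

/-! ### Conjugations by symmetric unitary matrices -/

section Conjugations

variable {d : ℕ}

theorem star_mulVec_eq_map_conj_mulVec (A : Matrix (Fin d) (Fin d) ℂ) (z : Fin d → ℂ) :
    star (A.mulVec z) = (A.map (starRingEnd ℂ)).mulVec (star z) := by
  ext i
  simp [Matrix.mulVec, dotProduct]

theorem conjExpr_zero_one (A : Matrix (Fin d) (Fin d) ℂ) (f : (Fin d → ℂ) → ℂ) (z : Fin d → ℂ) :
    conjExpr A 0 1 f z = starRingEnd ℂ (f (star (A.mulVec z))) := by
  simp [conjExpr]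

theorem measurePreserving_star :
    MeasurePreserving (fun z : Fin d → ℂ => star z) := by
  have h : MeasurePreserving (fun w : ℂ => star w) := Complex.conjLIE.measurePreserving
  exact volume_preserving_pi fun _ : Fin d => h

theorem measurePreserving_mulVec {A : Matrix (Fin d) (Fin d) ℂ}
    (hA : A ∈ Matrix.unitaryGroup (Fin d) ℂ) :
    MeasurePreserving (fun z : Fin d → ℂ => A.mulVec z) := by
  have hn : ‖A.det‖ = 1 := CStarRing.norm_of_mem_unitary (Matrix.det_of_mem_unitary hA)
  -- The real determinant of a complex-linear map is the squared modulus of its complex determinant.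
  have hdet : LinearMap.det (A.mulVecLin.restrictScalars ℝ) = 1 := by
    rw [LinearMap.det_restrictScalars, ← Matrix.toLin'_apply', LinearMap.det_toLin',
      Algebra.norm_complex_apply, Complex.normSq_eq_norm_sq, hn, one_pow]
  refine ⟨(A.mulVecLin.toContinuousLinearMap.continuous).measurable, ?_⟩
  have h := Measure.map_linearMap_addHaar_eq_smul_addHaar
    (volume : Measure (Fin d → ℂ)) (f := A.mulVecLin.restrictScalars ℝ) (by rw [hdet]; simp)
  rw [hdet, inv_one, abs_one, ENNReal.ofReal_one, one_smul] at h
  exact h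

theorem measurePreserving_star_mulVec {A : Matrix (Fin d) (Fin d) ℂ}
    (hA : A ∈ Matrix.unitaryGroup (Fin d) ℂ) :
    MeasurePreserving (fun z => star (A.mulVec z)) (gaussian d) (gaussian d) :=
  measurePreserving_gaussian (measurePreserving_star.comp (measurePreserving_mulVec hA))
    fun z => by simp [sum_norm_sq_mulVec hA]

theorem memFock_conjExpr {A : Matrix (Fin d) (Fin d) ℂ}
    (hA : A ∈ Matrix.unitaryGroup (Fin d) ℂ) {f : (Fin d → ℂ) → ℂ} (hf : MemFock f) :
    MemFock (conjExpr A 0 1 f) := by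
  have he : conjExpr A 0 1 f = fun z => star (f (star (A.mulVec z))) :=
    funext fun z => conjExpr_zero_one A f z
  rw [he]
  refine ⟨?_, (hf.2.comp_measurePreserving (measurePreserving_star_mulVec hA)).star⟩
  have h1 : Differentiable ℂ (star ∘ f ∘ star) := fun z => by
    simpa only [star_star] using (hf.1 (star z)).star_star
  exact h1.comp A.mulVecLin.toContinuousLinearMap.differentiable

/-- The antilinear map `𝒞_{A,0,1}` on the Fock space, for a unitary matrix `A`. -/
def conjMap (A : Matrix (Fin d) (Fin d) ℂ) (hA : A ∈ Matrix.unitaryGroup (Fin d) ℂ) :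
    FockSpace d →ₛₗ[starRingEnd ℂ] FockSpace d where
  toFun f := FockSpace.mk (conjExpr A 0 1 f) (memFock_conjExpr hA f.memFock)
  map_add' f g := FockSpace.ext fun z => by simp [conjExpr_zero_one]
  map_smul' c f := FockSpace.ext fun z => by simp [conjExpr_zero_one]

theorem conjMap_apply (A : Matrix (Fin d) (Fin d) ℂ) (hA : A ∈ Matrix.unitaryGroup (Fin d) ℂ)
    (f : FockSpace d) (z : Fin d → ℂ) :
    conjMap A hA f z = starRingEnd ℂ (f (star (A.mulVec z))) :=
  conjExpr_zero_one A f z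

/-- Symmetry makes the entrywise conjugate of `A` equal to `A*`, so that `z ↦ conj (A z)` is an
involution; unitarity makes it preserve the Gaussian measure. -/
theorem isConjugation_conjMap {A : Matrix (Fin d) (Fin d) ℂ}
    (hA : A ∈ Matrix.unitaryGroup (Fin d) ℂ) (hAt : A.transpose = A) :
    IsConjugation (conjMap A hA) := by
  have hmap : A.map (starRingEnd ℂ) = star A := by
    conv_lhs => rw [← hAt]
    rfl
  refine ⟨fun f => FockSpace.ext fun z => ?_, AddMonoidHomClass.isometry_of_norm _ fun f => ?_⟩
  · rw [conjMap_apply, conjMap_apply, Complex.conj_conj, star_mulVec_eq_map_conj_mulVec, star_star,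
      hmap, Matrix.mulVec_mulVec, Matrix.mem_unitaryGroup_iff'.1 hA, Matrix.one_mulVec]
  · have h1 : eLpNorm (conjMap A hA f) 2 (gaussian d) = eLpNorm f 2 (gaussian d) := by
      rw [← eLpNorm_comp_measurePreserving f.memFock.2.1 (measurePreserving_star_mulVec hA)]
      refine eLpNorm_congr_norm_ae (Eventually.of_forall fun z => ?_)
      rw [conjMap_apply, RCLike.norm_conj]
      rfl
    rw [FockSpace.eLpNorm_eq, FockSpace.eLpNorm_eq] at h1
    exact (ENNReal.ofReal_eq_ofReal_iff (norm_nonneg _) (norm_nonneg _)).1 h1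

variable {ψ : (Fin d → ℂ) → ℂ} {φ : (Fin d → ℂ) → (Fin d → ℂ)}
  {S : FockSpace d →ₗ.[ℂ] FockSpace d} {ε : ℂ}

/-- The two conditions on `A` say that `z ↦ conj (A z)` commutes with `φ`; the factor `ε` comes from
`α = ε conj α`. -/
theorem wcExpr_conjExpr {A Q : Matrix (Fin d) (Fin d) ℂ}
    (hA : A ∈ Matrix.unitaryGroup (Fin d) ℂ) {q : Fin d → ℂ} (hAq : A.mulVec q = star q)
    (hAQ : A * Q = Q.map (starRingEnd ℂ) * A) {α : ℂ} (hα : α = ε * starRingEnd ℂ α)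
    (hψ : ∀ z, ψ z = α * Complex.exp (pairing z q)) (hφ : ∀ z, φ z = Q.mulVec z + q)
    (f : (Fin d → ℂ) → ℂ) :
    wcExpr ψ φ (conjExpr A 0 1 f) = ε • conjExpr A 0 1 (wcExpr ψ φ f) := by
  funext z
  have h1 : star (A.mulVec (φ z)) = φ (star (A.mulVec z)) := by
    have h2 : star (Q.map (starRingEnd ℂ)) = Q.transpose := by
      ext i j
      simp [Matrix.star_apply]
    rw [hφ, hφ, Matrix.mulVec_add, hAq, Matrix.mulVec_mulVec, hAQ, star_add, star_star,
      ← Matrix.mulVec_mulVec, star_mulVec_eq_map_conj_mulVec (Q.map _)]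
    congr 2
    ext i j
    simp
  have h3 : starRingEnd ℂ (pairing (star (A.mulVec z)) q) = pairing z q := by
    have h4 : pairing (A.mulVec z) (star q) = pairing z q := by
      rw [← hAq, pairing_mulVec_left, Matrix.mulVec_mulVec, ← Matrix.star_eq_conjTranspose,
        Matrix.mem_unitaryGroup_iff'.1 hA, Matrix.one_mulVec]
    rw [← h4]
    simp [pairing]
  rw [Pi.smul_apply, smul_eq_mul, conjExpr_zero_one, wcExpr, wcExpr, conjExpr_zero_one, h1, hψ,
    hψ, map_mul, map_mul, ← Complex.exp_conj, h3, ← mul_assoc, ← mul_assoc, ← hα]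

theorem IsWCO.isABCSelfadjoint (hS : IsWCO ψ φ S) (h : IsEpsSymmetric ε S)
    (hε : ε = 1 ∨ ε = -1) {α : ℂ} (hα : α = ε * starRingEnd ℂ α)
    {A Q : Matrix (Fin d) (Fin d) ℂ} {q : Fin d → ℂ}
    (hψ : ∀ z, ψ z = α * Complex.exp (pairing z q)) (hφ : ∀ z, φ z = Q.mulVec z + q)
    (hdom : ∀ f : FockSpace d, f ∈ S.domain ↔ MemFock (wcExpr ψ φ f))
    (hA : A ∈ Matrix.unitaryGroup (Fin d) ℂ) (hAt : A.transpose = A)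
    (hAq : A.mulVec q = star q) (hAQ : A * Q = Q.map (starRingEnd ℂ) * A) :
    IsABCSelfadjoint A 0 1 S := by
  have hJ := isConjugation_conjMap hA hAt
  have hcomm := wcExpr_conjExpr hA hAq hAQ hα hψ hφ
  have hεε : ε * ε = 1 := by rcases hε with rfl | rfl <;> simp
  -- Maximality enters here: the description of the domain by `MemFock` is visibly stable under the
  -- conjugation.
  have hJdom : ∀ f ∈ S.domain, conjMap A hA f ∈ S.domain := fun f hf => by
    rw [hdom] at hf ⊢
    have h1 : wcExpr ψ φ (conjMap A hA f) = _ := hcomm f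
    rw [h1]
    exact (fockSubmodule d).smul_mem ε (memFock_conjExpr hA hf)
  refine ⟨conjMap A hA, fun f z => rfl, hJ, h.isClosed hε, h.1, ?_⟩
  refine LinearPMap.ext (Submodule.ext fun f => ?_) fun f hf hf' => ?_
  · change _ ↔ conjMap A hA f ∈ S.adjoint.domain
    rw [← h.mem_domain_iff]
    refine ⟨hJdom f, fun h1 => ?_⟩
    have h2 := hJdom _ h1
    rwa [hJ.1] at h2
  · have h1 : S ⟨conjMap A hA f, hJdom f hf⟩ = ε • conjMap A hA (S ⟨f, hf⟩) := by
      have h2 : (S ⟨f, hf⟩ : (Fin d → ℂ) → ℂ) = wcExpr ψ φ f := funext (hS.apply ⟨f, hf⟩)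
      refine FockSpace.ext fun z => ?_
      calc _ = wcExpr ψ φ (conjExpr A 0 1 f) z := hS.apply _ z
        _ = ε * conjExpr A 0 1 (wcExpr ψ φ f) z := congrFun (hcomm f) z
        _ = ε * conjExpr A 0 1 (S ⟨f, hf⟩) z := by rw [h2]
    have h2 := h.apply_eq (hJdom f hf) hf'
    have h3 : S.adjoint ⟨conjMap A hA f, hf'⟩ = conjMap A hA (S ⟨f, hf⟩) := by
      have h4 := congrArg (ε • ·) (h2.symm.trans h1)
      simpa only [smul_smul, hεε, one_smul] using h4
    change _ = conjMap A hA (S.adjoint ⟨conjMap A hA f, hf'⟩)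
    rw [h3, hJ.1]

end Conjugations

/-! ### The matrices `conj V (W Wᵀ) Vᴴ` -/

section Matrices

variable {d : ℕ}

theorem transpose_mem_unitaryGroup {V : Matrix (Fin d) (Fin d) ℂ}
    (hV : V ∈ Matrix.unitaryGroup (Fin d) ℂ) : V.transpose ∈ Matrix.unitaryGroup (Fin d) ℂ := by
  rw [Matrix.mem_unitaryGroup_iff]
  have h := congrArg Matrix.transpose (Matrix.mem_unitaryGroup_iff'.1 hV)
  rwa [Matrix.transpose_mul, Matrix.transpose_one] at h

theorem map_conj_mem_unitaryGroup {V : Matrix (Fin d) (Fin d) ℂ}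
    (hV : V ∈ Matrix.unitaryGroup (Fin d) ℂ) :
    V.map (starRingEnd ℂ) ∈ Matrix.unitaryGroup (Fin d) ℂ :=
  transpose_mem_unitaryGroup (Unitary.star_mem hV)

theorem map_conj_mul_transpose {V : Matrix (Fin d) (Fin d) ℂ}
    (hV : V ∈ Matrix.unitaryGroup (Fin d) ℂ) : V.map (starRingEnd ℂ) * V.transpose = 1 := by
  have h := Matrix.mem_unitaryGroup_iff'.1 (transpose_mem_unitaryGroup hV)
  exact h

theorem transpose_mul_map_conj {V : Matrix (Fin d) (Fin d) ℂ}
    (hV : V ∈ Matrix.unitaryGroup (Fin d) ℂ) : V.transpose * V.map (starRingEnd ℂ) = 1 :=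
  Matrix.mem_unitaryGroup_iff.1 (transpose_mem_unitaryGroup hV)

variable {V W : Matrix (Fin d) (Fin d) ℂ}

theorem conjMatrix_mem_unitaryGroup (hV : V ∈ Matrix.unitaryGroup (Fin d) ℂ)
    (hW : W ∈ Matrix.unitaryGroup (Fin d) ℂ) :
    V.map (starRingEnd ℂ) * (W * W.transpose) * V.conjTranspose ∈
      Matrix.unitaryGroup (Fin d) ℂ :=
  mul_mem (mul_mem (map_conj_mem_unitaryGroup hV) (mul_mem hW (transpose_mem_unitaryGroup hW)))
    (Unitary.star_mem hV)

theorem conjMatrix_transpose (V W : Matrix (Fin d) (Fin d) ℂ) :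
    (V.map (starRingEnd ℂ) * (W * W.transpose) * V.conjTranspose).transpose =
      V.map (starRingEnd ℂ) * (W * W.transpose) * V.conjTranspose := by
  have h1 : V.conjTranspose.transpose = V.map (starRingEnd ℂ) := rfl
  have h2 : (V.map (starRingEnd ℂ)).transpose = V.conjTranspose := rfl
  rw [Matrix.transpose_mul, Matrix.transpose_mul, Matrix.transpose_mul, h1, h2,
    Matrix.transpose_transpose, ← Matrix.mul_assoc]

theorem conjMatrix_mulVec (hV : V ∈ Matrix.unitaryGroup (Fin d) ℂ)
    (hW : W ∈ Matrix.unitaryGroup (Fin d) ℂ) {q : Fin d → ℂ}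
    (hq : ∀ i, (W.transpose.mulVec (V.conjTranspose.mulVec q) i).im = 0) :
    (V.map (starRingEnd ℂ) * (W * W.transpose) * V.conjTranspose).mulVec q = star q := by
  -- A real vector equals its conjugate. Once `Wᵀ V* q` is replaced by `W* Vᵀ conj q`, the unitary
  -- factors cancel and leave `conj q`.
  have hx : W.transpose.mulVec (V.conjTranspose.mulVec q) =
      W.conjTranspose.mulVec (V.transpose.mulVec (star q)) := by
    have h1 : star (W.transpose.mulVec (V.conjTranspose.mulVec q)) =
        W.conjTranspose.mulVec (V.transpose.mulVec (star q)) := by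
      rw [star_mulVec_eq_map_conj_mulVec, star_mulVec_eq_map_conj_mulVec]
      congr 2
      ext i j
      simp
    rw [← h1]
    funext i
    exact (Complex.conj_eq_iff_im.2 (hq i)).symm
  rw [← Matrix.mulVec_mulVec, ← Matrix.mulVec_mulVec, ← Matrix.mulVec_mulVec _ W, hx,
    Matrix.mulVec_mulVec _ W, ← Matrix.star_eq_conjTranspose W, Matrix.mem_unitaryGroup_iff.1 hW,
    Matrix.one_mulVec, Matrix.mulVec_mulVec, map_conj_mul_transpose hV, Matrix.one_mulVec]

theorem conjMatrix_mul (hV : V ∈ Matrix.unitaryGroup (Fin d) ℂ) {m : Fin d → ℝ}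
    (hW : ∀ i j, m i ≠ m j → W i j = 0) :
    V.map (starRingEnd ℂ) * (W * W.transpose) * V.conjTranspose *
        (V * Matrix.diagonal (fun i => (m i : ℂ)) * V.conjTranspose) =
      (V * Matrix.diagonal (fun i => (m i : ℂ)) * V.conjTranspose).map (starRingEnd ℂ) *
        (V.map (starRingEnd ℂ) * (W * W.transpose) * V.conjTranspose) := by
  set M := Matrix.diagonal fun i => (m i : ℂ)
  -- Block diagonality with respect to the eigenspaces of `M` is commutation with `M`, and `M` is
  -- real, so it can be moved through `W Wᵀ` unchanged.
  have hWM : W * M = M * W := by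
    ext i j
    simp only [M, Matrix.mul_diagonal, Matrix.diagonal_mul]
    by_cases hij : m i = m j
    · rw [hij, mul_comm]
    · simp [hW i j hij]
  have hWM' : W.transpose * M = M * W.transpose := by
    have h := congrArg Matrix.transpose hWM
    rw [Matrix.transpose_mul, Matrix.transpose_mul] at h
    simpa [M] using h.symm
  have hmap : (V * M * V.conjTranspose).map (starRingEnd ℂ) =
      V.map (starRingEnd ℂ) * M * V.transpose := by
    rw [Matrix.map_mul, Matrix.map_mul]
    congr 2
    · simp [M, Matrix.diagonal_map]
    · ext i j
      simp
  have hVV : V.conjTranspose * V = 1 := Matrix.mem_unitaryGroup_iff'.1 hV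
  rw [hmap]
  calc _ = V.map (starRingEnd ℂ) * W * W.transpose * (V.conjTranspose * V) * M *
        V.conjTranspose := by simp only [Matrix.mul_assoc]
    _ = V.map (starRingEnd ℂ) * W * (W.transpose * M) * V.conjTranspose := by
        rw [hVV]; simp only [Matrix.mul_assoc, Matrix.one_mul]
    _ = V.map (starRingEnd ℂ) * (W * M) * W.transpose * V.conjTranspose := by
        rw [hWM']; simp only [Matrix.mul_assoc]
    _ = V.map (starRingEnd ℂ) * M * (V.transpose * V.map (starRingEnd ℂ)) * W * W.transpose *
        V.conjTranspose := by
        rw [hWM, transpose_mul_map_conj hV]; simp only [Matrix.mul_assoc, Matrix.one_mul]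
    _ = _ := by simp only [Matrix.mul_assoc]

/-- A diagonal matrix of phases suffices: each rotates one coordinate of `u` onto the real axis. -/
theorem exists_unitary_diagonal_real (m : Fin d → ℝ) (u : Fin d → ℂ) :
    ∃ W ∈ Matrix.unitaryGroup (Fin d) ℂ, (∀ i j, m i ≠ m j → W i j = 0) ∧
      ∀ i, (W.transpose.mulVec u i).im = 0 := by
  have h : ∀ z : ℂ, ∃ c : ℂ, c * starRingEnd ℂ c = 1 ∧ (c * z).im = 0 := fun z => by
    by_cases hz : z = 0
    · exact ⟨1, by simp [hz]⟩
    · have hn : (‖z‖ : ℂ) ≠ 0 := by simpa using hz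
      have h2 : z * starRingEnd ℂ z = (‖z‖ : ℂ) * ‖z‖ := by
        rw [Complex.mul_conj, Complex.normSq_eq_norm_sq]
        push_cast
        ring
      refine ⟨starRingEnd ℂ z / ‖z‖, ?_, ?_⟩
      · rw [map_div₀, Complex.conj_conj, Complex.conj_ofReal, div_mul_div_comm, mul_comm, h2,
          div_self (mul_ne_zero hn hn)]
      · have h3 : starRingEnd ℂ z / ‖z‖ * z = ‖z‖ := by
          rw [div_mul_eq_mul_div, mul_comm, h2, mul_div_assoc, div_self hn, mul_one]
        rw [h3, Complex.ofReal_im]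
  choose c hc1 hc2 using fun i => h (u i)
  refine ⟨Matrix.diagonal c, ?_, fun i j hij => ?_, fun i => ?_⟩
  · rw [Matrix.mem_unitaryGroup_iff, Matrix.star_eq_conjTranspose, Matrix.diagonal_conjTranspose,
      Matrix.diagonal_mul_diagonal, ← Matrix.diagonal_one]
    congr 1
    funext i
    exact hc1 i
  · exact Matrix.diagonal_apply_ne _ fun hh => hij (hh ▸ rfl)
  · rw [Matrix.diagonal_transpose, Matrix.mulVec_diagonal]
    exact hc2 i

theorem exists_unitary_diagonalization {Q : Matrix (Fin d) (Fin d) ℂ} (hQ : Q.IsHermitian) :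
    ∃ V ∈ Matrix.unitaryGroup (Fin d) ℂ, ∃ m : Fin d → ℝ,
      Q = V * Matrix.diagonal (fun i => (m i : ℂ)) * V.conjTranspose :=
  ⟨hQ.eigenvectorUnitary, hQ.eigenvectorUnitary.2, hQ.eigenvalues, by
    have h := hQ.spectral_theorem
    rw [Unitary.conjStarAlgAut_apply] at h
    exact h⟩

end Matrices

end

end Fock

/-! ### Proof of the proposition. -/

theorem proposition2p9 (d : ℕ) (ψ : (Fin d → ℂ) → ℂ) (φ : (Fin d → ℂ) → (Fin d → ℂ))
    (hψ : Differentiable ℂ ψ) (hψ0 : ψ ≠ 0) (hφ : Differentiable ℂ φ)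
    (S : Fock.FockSpace d →ₗ.[ℂ] Fock.FockSpace d) (hS : Fock.IsWCO ψ φ S)
    (hsymm : Fock.IsRealSymmetric S ∨ Fock.IsSkewRealSymmetric S) :
    (∃ (A : Matrix (Fin d) (Fin d) ℂ) (b : Fin d → ℂ) (c : ℂ), Fock.IsABCSelfadjoint A b c S) ∧
    ∃ (Q : Matrix (Fin d) (Fin d) ℂ) (q : Fin d → ℂ),
      Q.IsHermitian ∧ (∀ z, φ z = Q.mulVec z + q) ∧
      (∃ V ∈ Matrix.unitaryGroup (Fin d) ℂ, ∃ m : Fin d → ℝ,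
        Q = V * Matrix.diagonal (fun i => (m i : ℂ)) * V.conjTranspose) ∧
      ∀ V ∈ Matrix.unitaryGroup (Fin d) ℂ, ∀ m : Fin d → ℝ,
        Q = V * Matrix.diagonal (fun i => (m i : ℂ)) * V.conjTranspose →
        (∃ W ∈ Matrix.unitaryGroup (Fin d) ℂ,
          (∀ i j, m i ≠ m j → W i j = 0) ∧
          ∀ i, (W.transpose.mulVec (V.conjTranspose.mulVec q) i).im = 0) ∧
        ∀ W ∈ Matrix.unitaryGroup (Fin d) ℂ,
          (∀ i j, m i ≠ m j → W i j = 0) →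
          (∀ i, (W.transpose.mulVec (V.conjTranspose.mulVec q) i).im = 0) →
          Fock.IsABCSelfadjoint
            (V.map (starRingEnd ℂ) * (W * W.transpose) * V.conjTranspose) 0 1 S := by
  obtain ⟨ε, hε, h⟩ : ∃ ε : ℂ, (ε = 1 ∨ ε = -1) ∧ Fock.IsEpsSymmetric ε S :=
    hsymm.elim (fun h => ⟨1, .inl rfl, h.isEpsSymmetric⟩)
      fun h => ⟨-1, .inr rfl, h.isEpsSymmetric⟩
  obtain ⟨α, Q, q, hα0, hα, hQ, hψ1, hφ1⟩ := hS.exists_symbols h hψ0 hφ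
  obtain ⟨V₀, hV₀, m₀, hQV₀⟩ := Fock.exists_unitary_diagonalization hQ
  have hmain : ∀ V ∈ Matrix.unitaryGroup (Fin d) ℂ, ∀ m : Fin d → ℝ,
      Q = V * Matrix.diagonal (fun i => (m i : ℂ)) * V.conjTranspose →
      ∀ W ∈ Matrix.unitaryGroup (Fin d) ℂ, (∀ i j, m i ≠ m j → W i j = 0) →
      (∀ i, (W.transpose.mulVec (V.conjTranspose.mulVec q) i).im = 0) →
      Fock.IsABCSelfadjoint
        (V.map (starRingEnd ℂ) * (W * W.transpose) * V.conjTranspose) 0 1 S := by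
    intro V hV m hQV W hW hWm hWq
    refine hS.isABCSelfadjoint h hε hα hψ1 hφ1
      (hS.mem_domain_iff h hε hα0 hα hV hψ1 fun z => by rw [hφ1, hQV])
      (Fock.conjMatrix_mem_unitaryGroup hV hW) (Fock.conjMatrix_transpose V W)
      (Fock.conjMatrix_mulVec hV hW hWq) ?_
    rw [hQV]
    exact Fock.conjMatrix_mul hV hWm
  refine ⟨?_, Q, q, hQ, hφ1, ⟨V₀, hV₀, m₀, hQV₀⟩, fun V hV m hQV =>
    ⟨Fock.exists_unitary_diagonal_real m _, hmain V hV m hQV⟩⟩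
  obtain ⟨W, hW, hWm, hWq⟩ := Fock.exists_unitary_diagonal_real m₀ (V₀.conjTranspose.mulVec q)
  exact ⟨_, 0, 1, hmain V₀ hV₀ m₀ hQV₀ W hW hWm hWq⟩
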